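/- Let $G:\mathbb R\to\mathbb R$ have a spectral density $\widehat G$, i.e. $G(x)=\int_{\mathbb R}\widehat G(t)e^{itx}\,dt$ with $\widehat G$ integrable, and suppose that $\widehat G(t)=e^{-S(|t|)}$ for $t\neq 0$, where $S\in C^2((0,\infty))$, $S'(t)\ge 0$ and $S''(t)\ge 0$ for all $t>0$, and $S'(t)\to+\infty$ as $t\to+\infty$. Put $T(s)=S(e^s)$ for $s\in\mathbb R$, $T^*(q)=\sup_{s\in\mathbb R}(qs-T(s))$, and $F(K)=T^*(2K+1)-(2K+1)\ln K$. Consider Expected-Improvement (EI) minimization of $f=-G$ over $[-1,1]$ with the covariance kernel $G(x'-x'')$. That is, let $(\xi_x)$ be the centered Gaussian process with covariance $\mathsf E(\xi_{x'}\xi_{x''})=G(x'-x'')$. For $K\ge 1$, points $x_1,\dots,x_K$ and $f^*_K=\min_{k\le K}f(x_k)$, let $$I_K(x)=\mathsf E\big(f_K^*-\min(f_K^*,\xi_x)\,\big|\,\xi_{x_k}=f(x_k),\ k=1,\dots,K\big),$$ where the conditional law of $\xi_x$ is the normal law with mean $\mathbf g_x^t\mathbf G^{-1}\mathbf f$ and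 variance $G(0)-\mathbf g_x^t\mathbf G^{-1}\mathbf g_x$, with $\mathbf f=(f(x_k))_k$, $\mathbf g_x=(G(x-x_k))_k$, $\mathbf G=(G(x_k-x_l))_{k,l}$. A trajectory is any sequence $x_1,x_2,\dots\in[-1,1]$ such that, for every $K\ge1$, $x_{K+1}$ is a maximizer of $I_K$ over $[-1,1]$ (any maximizer, if there are several). Then every such trajectory with $x_1=0$ converges to $0$; in particular, it is not dense in $[-1,1]$. Moreover, for all sufficiently large $K$, $$e^{2^K F(K)}\le |x_{K+1}|\le e^{F(K)/3}.$$ -/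

import Mathlib

open MeasureTheory ProbabilityTheory Filter Topology Set

namespace ExpectedImprovement

/-! ### The posterior law of a centered Gaussian process -/

section Posterior

/-- The covariance matrix `(G(x_k, x_l))_{k,l}` of the observed values at the points `p`. -/
def gramMatrix {α : Type*} (G : α → α → ℝ) {K : ℕ} (p : Fin K → α) :
    Matrix (Fin K) (Fin K) ℝ :=
  Matrix.of fun k l => G (p k) (p l)

/-- The vector `(G(x, x_k))_k`. -/
def crossCov {α : Type*} (G : α → α → ℝ) {K : ℕ} (p : Fin K → α) (x : α) : Fin K → ℝ :=
  fun k => G x (p k)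

/-- Conditional mean at `x`, given that the process takes the values `y` at the points `p`. -/
noncomputable def condMean {α : Type*} (G : α → α → ℝ) {K : ℕ} (p : Fin K → α) (x : α)
    (y : Fin K → ℝ) : ℝ :=
  crossCov G p x ⬝ᵥ (gramMatrix G p)⁻¹.mulVec y

/-- Conditional variance at `x`, given the values of the process at the points `p`. -/
noncomputable def condVar {α : Type*} (G : α → α → ℝ) {K : ℕ} (p : Fin K → α) (x : α) : ℝ :=
  G x x - crossCov G p x ⬝ᵥ (gramMatrix G p)⁻¹.mulVec (crossCov G p x)

/-- The conditional law of `ξ_x` given `ξ_{p k} = y k` for all `k`, where `ξ` is the centered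
Gaussian process with covariance function `G`, as a Markov kernel in the observed values `y`.
That this is the conditional law is `hasCondDistrib_posterior` below. -/
noncomputable def posterior {α : Type*} (G : α → α → ℝ) {K : ℕ} (p : Fin K → α) (x : α) :
    Kernel (Fin K → ℝ) ℝ where
  toFun y := gaussianReal (condMean G p x y) (condVar G p x).toNNReal
  measurable' := by
    have h : Measurable fun y : Fin K → ℝ => (condMean G p x y, (condVar G p x).toNNReal) := by
      refine Measurable.prodMk ?_ measurable_const
      unfold condMean dotProduct Matrix.mulVec dotProduct
      fun_prop
    exact measurable_gaussianReal.comp h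

/-- For every centered Gaussian process `ξ` with covariance function `G`, and every finite
family of points `p` with invertible covariance matrix, the conditional distribution of `ξ_x`
given the values `(ξ_{p k})_k` is the kernel `posterior G p x`. -/
theorem hasCondDistrib_posterior {α Ω : Type*} [MeasurableSpace Ω] {P : Measure Ω}
    {ξ : α → Ω → ℝ} {G : α → α → ℝ} (hξ : IsGaussianProcess ξ P)
    (hmean : ∀ a, ∫ ω, ξ a ω ∂P = 0) (hcov : ∀ a b, cov[ξ a, ξ b; P] = G a b)
    {K : ℕ} (p : Fin K → α) (hp : IsUnit (gramMatrix G p).det) (x : α) :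
    HasCondDistrib (ξ x) (fun ω k => ξ (p k) ω) (posterior G p x) P := by
  have := hξ.isProbabilityMeasure
  have hsymm : ∀ a b, G a b = G b a := fun a b => by
    rw [← hcov, ← hcov, covariance_comm]
  have hT : (gramMatrix G p).transpose = gramMatrix G p := by
    ext k l; exact hsymm _ _
  have hL2 : ∀ a, MemLp (ξ a) 2 P := fun a => (hξ.hasGaussianLaw_eval a).memLp_two
  set c : Fin K → ℝ := (gramMatrix G p)⁻¹.mulVec (crossCov G p x) with hc
  have hcm : ∀ y, condMean G p x y = ∑ k, c k * y k := fun y => by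
    rw [condMean, Matrix.dotProduct_mulVec, ← Matrix.mulVec_transpose, Matrix.transpose_nonsing_inv,
      hT]
    rfl
  have hgc : ∀ k, ∑ l, c l * G (p k) (p l) = G x (p k) := fun k => by
    have h1 : (gramMatrix G p).mulVec c = crossCov G p x := by
      rw [hc, Matrix.mulVec_mulVec, Matrix.mul_nonsing_inv _ hp, Matrix.one_mulVec]
    have h2 := congrFun h1 k
    simp only [Matrix.mulVec, dotProduct, gramMatrix, Matrix.of_apply, crossCov] at h2
    rw [← h2]
    exact Finset.sum_congr rfl fun l _ => mul_comm _ _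
  let η : Ω → ℝ := fun ω => ξ x ω - ∑ k, c k * ξ (p k) ω
  have hη : ∀ ω, η ω = ξ x ω - ∑ k, c k * ξ (p k) ω := fun _ => rfl
  -- the observations and the residual are jointly Gaussian
  have hW : IsGaussianProcess
      (Sum.elim (fun k : Fin K => ξ (p k)) (fun _ : Unit => η)) P := by
    classical
    refine hξ.of_isGaussianProcess fun s => ?_
    rcases s with k | u
    · exact ⟨{p k}, ContinuousLinearMap.proj ⟨p k, by simp⟩, fun ω => rfl⟩
    · refine ⟨insert x (Finset.univ.image p),
        ContinuousLinearMap.proj ⟨x, by simp⟩ -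
          ∑ k, c k • ContinuousLinearMap.proj ⟨p k, by simp⟩, fun ω => ?_⟩
      simp [hη, Finset.restrict_def]
  have hsum : MemLp (fun ω => ∑ k, c k * ξ (p k) ω) 2 P :=
    memLp_finsetSum _ fun k _ => (hL2 (p k)).const_mul _
  have hη2 : MemLp η 2 P := (hL2 x).sub hsum
  have hcovη : ∀ k, cov[ξ (p k), η; P] = 0 := fun k => by
    have : cov[ξ (p k), η; P] = G (p k) x - ∑ l, c l * G (p k) (p l) := by
      rw [show η = fun ω => ξ x ω - ∑ k, c k * ξ (p k) ω from rfl,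
        covariance_fun_sub_right (hL2 _) (hL2 _) hsum,
        covariance_fun_sum_right (fun l => (hL2 (p l)).const_mul _) (hL2 _), hcov]
      simp [covariance_const_mul_right, hcov]
    rw [this, hgc, hsymm, sub_self]
  have hind : IndepFun (fun ω (k : Fin K) => ξ (p k) ω) η P := by
    have h := hW.indepFun_of_covariance_eq_zero (fun k => hξ.aemeasurable (p k))
      (fun _ => hη2.aemeasurable) (fun k _ => hcovη k)
    exact h.comp (φ := id) (ψ := fun f : Unit → ℝ => f ()) measurable_id (measurable_pi_apply _)
  have hηG : HasGaussianLaw η P := hW.hasGaussianLaw_eval (Sum.inr ())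
  have hηm : P[η] = 0 := by
    have : P[η] = ∫ ω, ξ x ω ∂P - ∑ k, c k * ∫ ω, ξ (p k) ω ∂P := by
      rw [show η = fun ω => ξ x ω - ∑ k, c k * ξ (p k) ω from rfl,
        integral_sub ((hL2 x).integrable (by norm_num)) (hsum.integrable (by norm_num)),
        integral_finsetSum _ fun k _ => ((hL2 (p k)).const_mul _).integrable (by norm_num)]
      simp [integral_const_mul]
    simp [this, hmean]
  have hηv : Var[η; P] = condVar G p x := by
    rw [← covariance_self hη2.aemeasurable]
    have h1 : cov[η, η; P] = cov[ξ x, η; P] := by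
      conv_lhs => rw [show η = fun ω => ξ x ω - ∑ k, c k * ξ (p k) ω from rfl]
      rw [covariance_fun_sub_left (hL2 _) hsum hη2,
        covariance_fun_sum_left (fun l => (hL2 (p l)).const_mul _) hη2]
      simp [covariance_const_mul_left, hcovη]
    rw [h1, show η = fun ω => ξ x ω - ∑ k, c k * ξ (p k) ω from rfl,
      covariance_fun_sub_right (hL2 _) (hL2 _) hsum,
      covariance_fun_sum_right (fun l => (hL2 (p l)).const_mul _) (hL2 _), hcov]
    simp only [covariance_const_mul_right, hcov, condVar, ← hc, dotProduct, crossCov]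
    congr 1
    exact Finset.sum_congr rfl fun l _ => mul_comm _ _
  have hηlaw : P.map η = gaussianReal 0 (condVar G p x).toNNReal := by
    rw [hηG.map_eq_gaussianReal, hηm, hηv]
  have hX : AEMeasurable (fun ω (k : Fin K) => ξ (p k) ω) P :=
    aemeasurable_pi_lambda _ fun k => hξ.aemeasurable (p k)
  have hker : ∀ y, posterior G p x y =
      (gaussianReal 0 (condVar G p x).toNNReal).map (fun e => (∑ k, c k * y k) + e) := fun y => by
    rw [gaussianReal_map_const_add, zero_add, ← hcm]
    rfl
  have hmk : IsMarkovKernel (posterior G p x) := ⟨fun y => by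
    change IsProbabilityMeasure (gaussianReal _ _); infer_instance⟩
  have hmeas : Measurable fun q : (Fin K → ℝ) × ℝ => (q.1, (∑ k, c k * q.1 k) + q.2) := by
    fun_prop
  refine ⟨hX.prodMk (hξ.aemeasurable x), ?_⟩
  have e1 : P.map (fun ω => ((fun k => ξ (p k) ω), ξ x ω)) =
      (P.map (fun ω => ((fun k => ξ (p k) ω), η ω))).map
        (fun q : (Fin K → ℝ) × ℝ => (q.1, (∑ k, c k * q.1 k) + q.2)) := by
    rw [AEMeasurable.map_map_of_aemeasurable hmeas.aemeasurable (hX.prodMk hη2.aemeasurable)]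
    congr 1
    ext ω <;> simp [hη]
  rw [e1, (indepFun_iff_map_prod_eq_prod_map_map hX hη2.aemeasurable).1 hind, hηlaw]
  ext s hs
  rw [Measure.map_apply hmeas hs, Measure.prod_apply (hmeas hs), Measure.compProd_apply hs]
  refine lintegral_congr fun y => ?_
  rw [hker, Measure.map_apply (by fun_prop) (measurable_prodMk_left hs)]
  rfl

end Posterior

/-! ### Expected Improvement optimization -/

section Algorithm

/-- The expected improvement `E(f* - min(f*, ξ_x) | ξ_{p k} = y k, k)` at `x`, where
`f* = min_k y k` and `ξ` is the centered Gaussian process with covariance function `G`. -/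
noncomputable def expectedImprovement {α : Type*} (G : α → α → ℝ) {K : ℕ} (p : Fin K → α)
    (y : Fin K → ℝ) (x : α) : ℝ :=
  ∫ t, ((⨅ k, y k) - min (⨅ k, y k) t) ∂(posterior G p x y)

/-- `x 1, x 2, …` is a trajectory of Expected Improvement minimization of `f` over `D` with
covariance function `G`: after the observation of `f` at `x 1, …, x K`, the next point
`x (K + 1)` is some maximizer over `D` of the expected improvement. (`x 0` plays no role.) -/
def IsTrajectory {α : Type*} (G : α → α → ℝ) (D : Set α) (f : α → ℝ) (x : ℕ → α) : Prop :=
  x 1 ∈ D ∧ ∀ K : ℕ, 1 ≤ K → x (K + 1) ∈ D ∧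
    IsMaxOn (expectedImprovement G (fun k : Fin K => x (k + 1)) (fun k : Fin K => f (x (k + 1))))
      D (x (K + 1))

end Algorithm

/-! ### Spectral densities -/

section Spectral

/-- `G(x) = ∫ Ghat(t) e^{itx} dt` for all `x`, with an integrable `Ghat`. -/
def HasSpectralDensity (G Ghat : ℝ → ℝ) : Prop :=
  Integrable Ghat ∧
    ∀ x : ℝ, (G x : ℂ) = ∫ t : ℝ, (Ghat t : ℂ) * Complex.exp (Complex.I * t * x)

/-- `Ghat(t) = e^{-S(|t|)}` (for `t ≠ 0`), where `S` is `C²` on `(0, ∞)`, `S', S'' ≥ 0` there,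
and `S'(t) → +∞` as `t → +∞`. -/
structure IsRapidlyDecaying (Ghat S : ℝ → ℝ) : Prop where
  eq_exp : ∀ t : ℝ, t ≠ 0 → Ghat t = Real.exp (-S |t|)
  contDiffOn : ContDiffOn ℝ 2 S (Ioi 0)
  deriv_nonneg : ∀ t : ℝ, 0 < t → 0 ≤ deriv S t
  deriv_deriv_nonneg : ∀ t : ℝ, 0 < t → 0 ≤ deriv (deriv S) t
  tendsto_deriv : Tendsto (deriv S) atTop atTop

/-- The Legendre transform `T*(q) = sup_s (q s - T(s))`. -/
noncomputable def legendre (T : ℝ → ℝ) (q : ℝ) : ℝ := ⨆ s : ℝ, (q * s - T s)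

/-- `F(K) = T*(2K + 1) - (2K + 1) ln K`, where `T(s) = S(e^s)`. -/
noncomputable def rate (S : ℝ → ℝ) (K : ℕ) : ℝ :=
  legendre (fun s => S (Real.exp s)) (2 * K + 1) - (2 * K + 1) * Real.log K

end Spectral

end ExpectedImprovement

/-! The point `x_1 = 0` is the global minimum of `f = -G`, so the best observed value is `-G(0)`
forever, and since `f` is minus the covariance with the observation at `0`, the conditional mean is
`f` itself (`expectedImprovement_neg_eq`). Hence `I_K(x)` is the improvement of a normal variable
whose mean exceeds the best value by the gap `G(0) - G(x)`, which is comparable to `x²`, and whose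
standard deviation is `σ_K(x)`. It is of order `σ_K(x)` if the gap is at most `σ_K(x)`, and at most
`λ⁻¹ exp(-λ (G(0) - G(x)) + λ² σ_K(x)² / 2)` for every `λ > 0`.

The variance `σ_K(x)²` is the squared distance in `L²(Ĝ)` of `e^{itx}` from the span of the
`e^{itx_k}`; it is comparable to `∏ (x - x_k)²`, up to factors that depend only on `K`.
* Upper bound (`condVar_le_exp_rate`): interpolate `e^{itx}` by polynomials in `x`. The error is at
  most `|t|^K / K! ∏ |x - x_k|`, and the moment `∫ t^{2K} Ĝ(t) dt` is at most a power `C^K` times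
  `e^{T*(2K+1)}`, by comparison of `S` with its tangent at the point where `T*(2K+1)` is attained.
  The factor is `e^{F(K) + O(K)}`, and `F(K) / K → -∞`.
* Lower bound (`prod_le_condVar`): the product of the difference operators
  `E ↦ E(· + h) - e^{ihx_k} E` annihilates every `e^{itx_k}`, multiplies `e^{itx}` by
  `∏ (e^{ihx} - e^{ihx_k})`, and is bounded on `L²(0, 1)`, where `Ĝ ≥ e^{-S(1)}`. The factor is
  crude, but not less than `e^{-O(K²)}`.

Let `P_K` be the product of the `|x_k|`, `2 ≤ k ≤ K`. At a point `y` of order `e^{-O(K²)} P_K` the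
gap is below `σ_K(y)`, so the maximum of `I_K` is at least `e^{-O(K²)} P_K²`. On the other hand
`I_K(x) = O(∏ |x - x_k|)`, so the maximizer satisfies `|x_{K+1}| ≥ e^{-O(K²)} P_K`
(`exists_exp_mul_prod_le_abs_of_isMaxOn`). Therefore `P_{K+1} ≥ e^{-O(K²)} P_K²`, which gives
`P_K ≥ e^{-A 2^K}` for a constant `A` and, as `F(K) → -∞`, the lower bound on `|x_{K+1}|`. If
`|x| > e^{F(K)/3}`, then the gap is so large a multiple of `σ_K(x)` that `I_K(x)` is at most
`exp(-c e^{-F(K)/3 - O(K)})`, which is less than the maximum since `F(K) / K → -∞`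
(`IsTrajectory.eventually_abs_le_exp_rate`). -/

namespace ExpectedImprovement

/-! ### The error of Lagrange interpolation -/

/-- Iterated Rolle theorem; `F k` is the `k`-th derivative of `F 0`. -/
theorem exists_eq_zero_of_strictMono_zeros {F : ℕ → ℝ → ℝ}
    (hF : ∀ k y, HasDerivAt (F k) (F (k + 1) y) y) (n : ℕ) :
    ∀ (k : ℕ) (z : Fin (n + 1) → ℝ), StrictMono z → (∀ i, F k (z i) = 0) →
      ∃ y, F (k + n) y = 0 := by
  induction n with
  | zero => exact fun k z _ h => ⟨z 0, h 0⟩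
  | succ n ih =>
    intro k z hz h0
    have h : ∀ i : Fin (n + 1), ∃ y ∈ Ioo (z i.castSucc) (z i.succ), F (k + 1) y = 0 := fun i =>
      exists_hasDerivAt_eq_zero (hz i.castSucc_lt_succ)
        (fun y _ => (hF k y).continuousAt.continuousWithinAt) (by rw [h0, h0])
        fun y _ => hF k y
    choose w hw hw0 using h
    have hmono : StrictMono w := by
      refine Fin.strictMono_iff_lt_succ.2 fun i => ?_
      have h1 := (hw i.castSucc).2
      have h2 := (hw i.succ).1
      rw [Fin.succ_castSucc] at h1
      exact h1.trans h2
    obtain ⟨y, hy⟩ := ih (k + 1) w hmono hw0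
    exact ⟨y, by rwa [show k + (n + 1) = k + 1 + n by ring]⟩

/-- A monic polynomial of degree `n` has `n`-th derivative `n!`. -/
theorem iterate_derivative_of_monic {p : Polynomial ℝ} (hp : p.Monic) {n : ℕ}
    (hn : p.degree = n) : Polynomial.derivative^[n] p = Polynomial.C (n.factorial : ℝ) := by
  have h1 : p = (p - Polynomial.X ^ n) + Polynomial.X ^ n := by ring
  have h2 : (p - Polynomial.X ^ n).degree < (n : WithBot ℕ) := by
    rw [← hn]
    refine Polynomial.degree_sub_lt_left ?_ hp.ne_zero ?_
    · rw [hn, Polynomial.degree_X_pow]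
    · rw [hp.leadingCoeff, Polynomial.leadingCoeff_X_pow]
  rw [h1, iterate_map_add,
    Polynomial.iterate_derivative_eq_zero_of_degree_lt h2,
    Polynomial.iterate_derivative_X_pow_eq_C_mul]
  simp [Nat.descFactorial_self]

/-- The error of interpolation by a polynomial of degree `< n` at `n` distinct nodes, for a
function `φ 0` whose derivatives are `φ 1, φ 2, …`. -/
theorem abs_sub_sum_lagrange_le {φ : ℕ → ℝ → ℝ}
    (hφ : ∀ k y, HasDerivAt (φ k) (φ (k + 1) y) y) {n : ℕ} {M : ℝ} (hM : ∀ y, |φ n y| ≤ M)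
    {p : Fin n → ℝ} (hp : Function.Injective p) (x : ℝ) :
    |φ 0 x - ∑ i, φ 0 (p i) * (Lagrange.basis Finset.univ p i).eval x| ≤
      M / n.factorial * ∏ i, |x - p i| := by
  set P := Lagrange.interpolate Finset.univ p (fun i => φ 0 (p i)) with hP
  have hPx : ∀ y, P.eval y = ∑ i, φ 0 (p i) * (Lagrange.basis Finset.univ p i).eval y := fun y => by
    simp [hP, Lagrange.interpolate_apply, Polynomial.eval_finsetSum]
  rw [← hPx]
  have hPp : ∀ i, P.eval (p i) = φ 0 (p i) := fun i =>
    Lagrange.eval_interpolate_at_node _ hp.injOn (Finset.mem_univ i)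
  have hM0 : 0 ≤ M := (abs_nonneg _).trans (hM 0)
  by_cases hx : ∃ i, x = p i
  · obtain ⟨i, rfl⟩ := hx
    rw [hPp, sub_self, abs_zero]
    positivity
  push Not at hx
  set w := Lagrange.nodal Finset.univ p with hw
  have hwx : w.eval x = ∏ i, (x - p i) := Lagrange.eval_nodal
  have hwx0 : w.eval x ≠ 0 := by
    rw [hwx]; exact Finset.prod_ne_zero_iff.2 fun i _ => sub_ne_zero.2 (hx i)
  set l := (φ 0 x - P.eval x) / w.eval x with hl
  -- with this `l`, the function `φ 0 - Q` vanishes at `x` as well as at the nodes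
  set Q := P + Polynomial.C l * w with hQ
  let F : ℕ → ℝ → ℝ := fun k y => φ k y - (Polynomial.derivative^[k] Q).eval y
  have hF : ∀ k y, HasDerivAt (F k) (F (k + 1) y) y := fun k y => by
    have h := (hφ k y).sub ((Polynomial.derivative^[k] Q).hasDerivAt y)
    simp only [F, Function.iterate_succ_apply']
    exact h
  let s : Finset ℝ := insert x (Finset.univ.image p)
  have hs : s.card = n + 1 := by
    rw [Finset.card_insert_of_notMem, Finset.card_image_of_injective _ hp, Finset.card_univ,
      Fintype.card_fin]
    simpa using fun i h => hx i h.symm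
  have hzero : ∀ y ∈ s, F 0 y = 0 := by
    intro y hy
    rcases Finset.mem_insert.1 hy with rfl | hy
    · simp [F, hQ, hl, div_mul_cancel₀ _ hwx0]
    · obtain ⟨i, -, rfl⟩ := Finset.mem_image.1 hy
      simp [F, hQ, hPp, hw, Lagrange.eval_nodal_at_node (Finset.mem_univ i)]
  obtain ⟨y, hy⟩ := exists_eq_zero_of_strictMono_zeros hF n 0 (s.orderEmbOfFin hs)
    (s.orderEmbOfFin hs).strictMono fun i => hzero _ (s.orderEmbOfFin_mem hs i)
  have hQn : Polynomial.derivative^[n] Q = Polynomial.C (l * n.factorial) := by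
    rw [hQ, iterate_map_add, Polynomial.iterate_derivative_C_mul,
      Polynomial.iterate_derivative_eq_zero_of_degree_lt, iterate_derivative_of_monic]
    · simp
    · exact Lagrange.nodal_monic
    · simp [hw]
    · have h := Lagrange.degree_interpolate_lt (s := Finset.univ) (fun i => φ 0 (p i)) hp.injOn
      rwa [Finset.card_univ, Fintype.card_fin] at h
  have hy' : φ n y = l * n.factorial := by
    have : F n y = 0 := by simpa using hy
    simp only [F, hQn, Polynomial.eval_C] at this
    linarith
  have hfac : (0 : ℝ) < n.factorial := by exact_mod_cast n.factorial_pos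
  have hl' : |l| ≤ M / n.factorial := by
    rw [le_div_iff₀ hfac]
    have := hM y
    rwa [hy', abs_mul, abs_of_pos hfac] at this
  have : φ 0 x - P.eval x = l * w.eval x := by rw [hl, div_mul_cancel₀ _ hwx0]
  rw [this, abs_mul, hwx, Finset.abs_prod]
  gcongr

theorem abs_cos_sub_sum_lagrange_le (t θ : ℝ) {n : ℕ} {p : Fin n → ℝ}
    (hp : Function.Injective p) (x : ℝ) :
    |Real.cos (t * x + θ) -
        ∑ i, Real.cos (t * p i + θ) * (Lagrange.basis Finset.univ p i).eval x| ≤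
      |t| ^ n / n.factorial * ∏ i, |x - p i| := by
  let φ : ℕ → ℝ → ℝ := fun k y => t ^ k * Real.cos (t * y + θ + k * (Real.pi / 2))
  have hφ : ∀ k y, HasDerivAt (φ k) (φ (k + 1) y) y := fun k y => by
    have h := ((((hasDerivAt_id y).const_mul t).add_const (θ + k * (Real.pi / 2))).cos).const_mul
      (t ^ k)
    have e : φ k = fun y => t ^ k * Real.cos (t * id y + (θ + k * (Real.pi / 2))) := by
      funext y; simp only [φ, id, add_assoc]
    rw [e]
    refine h.congr_deriv ?_
    simp only [φ, id, Nat.cast_add, Nat.cast_one, add_mul, one_mul, ← add_assoc,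
      Real.cos_add_pi_div_two]
    ring
  have hM : ∀ y, |φ n y| ≤ |t| ^ n := fun y => by
    simp only [φ, abs_mul, abs_pow]
    exact mul_le_of_le_one_right (by positivity) (Real.abs_cos_le_one _)
  simpa [φ] using abs_sub_sum_lagrange_le hφ hM hp x

/-- The error of interpolation of `x ↦ e^{itx}`. -/
theorem norm_exp_sub_sum_lagrange_sq_le (t : ℝ) {n : ℕ} {p : Fin n → ℝ}
    (hp : Function.Injective p) (x : ℝ) :
    ‖Complex.exp (Complex.I * t * x) -
        ∑ i, (((Lagrange.basis Finset.univ p i).eval x : ℝ) : ℂ) * Complex.exp (Complex.I * t * p i)‖ ^ 2 ≤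
      2 * (t ^ (2 * n) / n.factorial ^ 2 * ∏ i, (x - p i) ^ 2) := by
  have hexp : ∀ y : ℝ, Complex.exp (Complex.I * t * y) =
      (Real.cos (t * y + 0) : ℂ) + (Real.cos (t * y + -(Real.pi / 2)) : ℂ) * Complex.I := fun y => by
    rw [← sub_eq_add_neg, Real.cos_sub_pi_div_two, add_zero, Complex.ofReal_cos, Complex.ofReal_sin,
      ← Complex.exp_mul_I]
    congr 1; push_cast; ring
  have hsum : Complex.exp (Complex.I * t * x) -
        ∑ i, (((Lagrange.basis Finset.univ p i).eval x : ℝ) : ℂ) * Complex.exp (Complex.I * t * p i) =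
      ((Real.cos (t * x + 0) -
        ∑ i, Real.cos (t * p i + 0) * (Lagrange.basis Finset.univ p i).eval x : ℝ) : ℂ) +
      ((Real.cos (t * x + -(Real.pi / 2)) - ∑ i, Real.cos (t * p i + -(Real.pi / 2)) *
        (Lagrange.basis Finset.univ p i).eval x : ℝ) : ℂ) * Complex.I := by
    simp only [hexp, Complex.ofReal_sub, Complex.ofReal_sum, Complex.ofReal_mul, mul_add,
      Finset.sum_add_distrib, sub_mul, Finset.sum_mul]
    rw [add_sub_add_comm]
    congr 2 <;> refine Finset.sum_congr rfl fun i _ => ?_ <;> ring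
  rw [hsum, Complex.sq_norm, Complex.normSq_add_mul_I]
  have h1 := sq_le_sq.2 ((abs_cos_sub_sum_lagrange_le t 0 hp x).trans (le_abs_self _))
  have h2 := sq_le_sq.2 ((abs_cos_sub_sum_lagrange_le t (-(Real.pi / 2)) hp x).trans
    (le_abs_self _))
  have h3 : (|t| ^ n / n.factorial * ∏ i, |x - p i|) ^ 2 =
      t ^ (2 * n) / n.factorial ^ 2 * ∏ i, (x - p i) ^ 2 := by
    rw [mul_pow, div_pow, ← pow_mul, mul_comm n 2, Finset.prod_pow, ← Finset.abs_prod, sq_abs,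
      (even_two_mul n).pow_abs]
  rw [h3] at h1 h2
  linarith

/-! ### A lower bound for exponential sums -/

theorem integral_norm_shift_sub_sq_le {E : ℝ → ℂ} (hE : Continuous E) {w : ℂ} (hw : ‖w‖ = 1)
    {a h : ℝ} (ha : 0 ≤ a) (hh : 0 ≤ h) :
    ∫ t in (0 : ℝ)..a, ‖E (t + h) - w * E t‖ ^ 2 ≤ 4 * ∫ t in (0 : ℝ)..(a + h), ‖E t‖ ^ 2 := by
  have hc : Continuous fun t => ‖E t‖ ^ 2 := by fun_prop
  have h1 : ∫ t in (0 : ℝ)..a, ‖E (t + h) - w * E t‖ ^ 2 ≤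
      ∫ t in (0 : ℝ)..a, (2 * ‖E (t + h)‖ ^ 2 + 2 * ‖E t‖ ^ 2) := by
    refine intervalIntegral.integral_mono_on ha ?_ ?_ fun t _ => ?_
    · exact Continuous.intervalIntegrable (by fun_prop) _ _
    · exact Continuous.intervalIntegrable (by fun_prop) _ _
    · have h2 : ‖E (t + h) - w * E t‖ ≤ ‖E (t + h)‖ + ‖E t‖ := by
        refine (norm_sub_le _ _).trans_eq ?_
        rw [norm_mul, hw, one_mul]
      nlinarith [norm_nonneg (E (t + h) - w * E t), sq_nonneg (‖E (t + h)‖ - ‖E t‖)]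
  have hI : ∀ {u v : ℝ}, IntervalIntegrable (fun t => ‖E t‖ ^ 2) volume u v :=
    hc.intervalIntegrable _ _
  have hI' : IntervalIntegrable (fun t => ‖E (t + h)‖ ^ 2) volume 0 a :=
    Continuous.intervalIntegrable (by fun_prop) _ _
  rw [intervalIntegral.integral_add (hI'.const_mul 2) (hI.const_mul 2),
    intervalIntegral.integral_const_mul, intervalIntegral.integral_const_mul,
    intervalIntegral.integral_comp_add_right (fun t => ‖E t‖ ^ 2), zero_add] at h1
  have h3 : ∫ t in h..(a + h), ‖E t‖ ^ 2 ≤ ∫ t in (0 : ℝ)..(a + h), ‖E t‖ ^ 2 := by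
    rw [← intervalIntegral.integral_add_adjacent_intervals (hI (u := 0) (v := h))
      (hI (u := h) (v := a + h))]
    exact le_add_of_nonneg_left (intervalIntegral.integral_nonneg hh fun t _ => by positivity)
  have h4 : ∫ t in (0 : ℝ)..a, ‖E t‖ ^ 2 ≤ ∫ t in (0 : ℝ)..(a + h), ‖E t‖ ^ 2 := by
    rw [← intervalIntegral.integral_add_adjacent_intervals (hI (u := 0) (v := a))
      (hI (u := a) (v := a + h))]
    exact le_add_of_nonneg_right
      (intervalIntegral.integral_nonneg (by linarith) fun t _ => by positivity)
  linarith

/-- The difference operators `E ↦ E(· + h) - e^{ihp} E`, for `p` in `s`, annihilate the exponentials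
with frequency in `s` and multiply `e^{itx}` by `e^{ihx} - e^{ihp}`. -/
theorem prod_norm_sub_sq_le_integral_exp_sum (x : ℝ) {h a : ℝ} (hh : 0 ≤ h) (ha : 0 ≤ a)
    {ι : Type*} [DecidableEq ι] (p : ι → ℝ) (s : Finset ι) : ∀ (c : ι → ℂ) (b : ℂ),
    ‖b‖ ^ 2 * (∏ k ∈ s, ‖Complex.exp (Complex.I * h * x) - Complex.exp (Complex.I * h * p k)‖ ^ 2)
      * a ≤ 4 ^ s.card * ∫ t in (0 : ℝ)..(a + s.card * h),
        ‖b * Complex.exp (Complex.I * t * x) +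
          ∑ k ∈ s, c k * Complex.exp (Complex.I * t * p k)‖ ^ 2 := by
  induction s using Finset.induction_on with
  | empty =>
    intro c b
    have : ∀ t : ℝ, ‖Complex.exp (Complex.I * t * x)‖ = 1 := fun t => by
      rw [mul_assoc, ← Complex.ofReal_mul, Complex.norm_exp_I_mul_ofReal]
    simp [this]
    rw [mul_comm]
  | insert j s hj ih =>
    intro c b
    let w : ι → ℂ := fun k => Complex.exp (Complex.I * h * p k)
    let wx : ℂ := Complex.exp (Complex.I * h * x)
    let E : ℝ → ℂ := fun t => b * Complex.exp (Complex.I * t * x) +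
      ∑ k ∈ insert j s, c k * Complex.exp (Complex.I * t * p k)
    have hE : Continuous E := by fun_prop
    have hw : ‖w j‖ = 1 := by
      simp only [w]
      rw [mul_assoc, ← Complex.ofReal_mul, Complex.norm_exp_I_mul_ofReal]
    have hexp : ∀ t y : ℝ, Complex.exp (Complex.I * (t + h : ℝ) * y) =
        Complex.exp (Complex.I * h * y) * Complex.exp (Complex.I * t * y) := fun t y => by
      rw [← Complex.exp_add]; congr 1; push_cast; ring
    have hΔ : ∀ t, E (t + h) - w j * E t = (b * (wx - w j)) * Complex.exp (Complex.I * t * x) +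
        ∑ k ∈ s, (c k * (w k - w j)) * Complex.exp (Complex.I * t * p k) := fun t => by
      simp only [E, hexp, Finset.sum_insert hj]
      have : ∑ k ∈ s, (c k * (w k - w j)) * Complex.exp (Complex.I * t * p k) =
          ∑ k ∈ s, c k * (Complex.exp (Complex.I * h * p k) * Complex.exp (Complex.I * t * p k)) -
            w j * ∑ k ∈ s, c k * Complex.exp (Complex.I * t * p k) := by
        rw [Finset.mul_sum, ← Finset.sum_sub_distrib]
        exact Finset.sum_congr rfl fun k _ => by simp only [w]; ring
      rw [this]
      simp only [w, wx]
      ring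
    have h1 := ih (fun k => c k * (w k - w j)) (b * (wx - w j))
    simp only [← hΔ] at h1
    have h2 := integral_norm_shift_sub_sq_le hE hw (a := a + s.card * h) (h := h)
      (by positivity) hh
    rw [Finset.prod_insert hj, Finset.card_insert_of_notMem hj]
    calc _ = ‖b * (wx - w j)‖ ^ 2 * (∏ k ∈ s, ‖Complex.exp (Complex.I * h * x) -
            Complex.exp (Complex.I * h * p k)‖ ^ 2) * a := by
          rw [norm_mul, mul_pow]; ring
      _ ≤ _ := h1
      _ ≤ 4 ^ s.card * (4 * ∫ t in (0 : ℝ)..(a + s.card * h + h), ‖E t‖ ^ 2) := by gcongr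
      _ = _ := by
          rw [pow_succ, mul_assoc, Nat.cast_succ, add_one_mul, ← add_assoc]

theorem abs_sub_div_two_le_norm_exp_sub {u v : ℝ} (h : |u - v| ≤ 2) :
    |u - v| / 2 ≤ ‖Complex.exp (Complex.I * u) - Complex.exp (Complex.I * v)‖ := by
  have h1 : Complex.exp (Complex.I * u) - Complex.exp (Complex.I * v) =
      Complex.exp (Complex.I * v) * (Complex.exp (Complex.I * (u - v : ℝ)) - 1) := by
    rw [mul_sub, ← Complex.exp_add, mul_one]; congr 2; push_cast; ring
  rw [h1, norm_mul, Complex.norm_exp_I_mul_ofReal, one_mul,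
    Complex.norm_exp_I_mul_ofReal_sub_one, norm_mul, Real.norm_eq_abs, Real.norm_eq_abs, abs_two]
  have h2 : |(u - v) / 2| ≤ Real.pi / 2 := by
    rw [abs_div, abs_two]; linarith [Real.pi_gt_three]
  have h3 := Real.mul_abs_le_abs_sin h2
  have h4 : 1 / 2 ≤ 2 / Real.pi := by
    rw [div_le_div_iff₀ (by norm_num) Real.pi_pos]; linarith [Real.pi_le_four]
  have h5 : |(u - v) / 2| = |u - v| / 2 := by rw [abs_div, abs_two]
  rw [h5] at h3
  have h6 := mul_le_mul_of_nonneg_right h4 (a := |u - v| / 2) (by positivity)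
  linarith

/-- The squared distance of `b e^{itx}` from the span of `e^{itp_k}` in `L²(0, 1)` is at least
`b² ∏ (x - p_k)²`, up to a factor that depends only on the number of points. -/
theorem sq_mul_prod_le_integral_exp_sum {ι : Type*} [DecidableEq ι] {p : ι → ℝ} {x : ℝ}
    {s : Finset ι} (hp : ∀ k ∈ s, |x - p k| ≤ 2) (c : ι → ℂ) (b : ℂ) :
    ‖b‖ ^ 2 * ∏ k ∈ s, (x - p k) ^ 2 ≤ (4 * ((s.card : ℝ) + 1)) ^ (2 * s.card + 1) *
      ∫ t in (0 : ℝ)..1, ‖b * Complex.exp (Complex.I * t * x) +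
          ∑ k ∈ s, c k * Complex.exp (Complex.I * t * p k)‖ ^ 2 := by
  set n := s.card with hn
  set N : ℝ := (n : ℝ) + 1 with hN
  have hN1 : 1 ≤ N := by simp [hN]
  -- `n` shifts by this `h` keep the interval `[0, h]` inside `[0, 1]`
  set h : ℝ := 1 / N with hh
  have hh0 : 0 < h := by positivity
  have hh1 : h ≤ 1 := by rw [hh, div_le_one (by positivity)]; exact hN1
  have key := prod_norm_sub_sq_le_integral_exp_sum x hh0.le hh0.le p s c b
  rw [← hn, show h + n * h = 1 by rw [hh]; field_simp; rw [hN]; ring] at key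
  set J := ∫ t in (0 : ℝ)..1, ‖b * Complex.exp (Complex.I * t * x) +
          ∑ k ∈ s, c k * Complex.exp (Complex.I * t * p k)‖ ^ 2 with hJ
  have hJ0 : 0 ≤ J := intervalIntegral.integral_nonneg zero_le_one fun t _ => by positivity
  have hprod : (∏ k ∈ s, (x - p k) ^ 2) * (h / 2) ^ (2 * n) ≤
      ∏ k ∈ s, ‖Complex.exp (Complex.I * h * x) - Complex.exp (Complex.I * h * p k)‖ ^ 2 := by
    rw [pow_mul, hn, ← Finset.prod_const, ← Finset.prod_mul_distrib]
    refine Finset.prod_le_prod (fun k _ => by positivity) fun k hk => ?_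
    have h1 : |h * x - h * p k| ≤ 2 := by
      rw [← mul_sub, abs_mul, abs_of_pos hh0]
      exact (mul_le_of_le_one_left (abs_nonneg _) hh1).trans (hp k hk)
    have h2 := abs_sub_div_two_le_norm_exp_sub h1
    rw [← mul_sub, abs_mul, abs_of_pos hh0] at h2
    push_cast at h2
    rw [← mul_assoc, ← mul_assoc] at h2
    calc (x - p k) ^ 2 * (h / 2) ^ 2 = (h * |x - p k| / 2) ^ 2 := by
          rw [← sq_abs (x - p k)]; ring
      _ ≤ _ := by gcongr
  have h3 : ‖b‖ ^ 2 * (∏ k ∈ s, (x - p k) ^ 2) * ((h / 2) ^ (2 * n) * h) ≤ 4 ^ n * J := by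
    refine le_trans ?_ key
    rw [← mul_assoc]
    refine mul_le_mul_of_nonneg_right ?_ hh0.le
    rw [mul_assoc]
    gcongr
  have h4 : (h / 2) ^ (2 * n) * h * (4 ^ n * N ^ (2 * n + 1)) = 1 := by
    rw [hh, show (4 : ℝ) = 2 ^ 2 by norm_num, ← pow_mul, pow_succ, div_div, div_pow, one_pow,
      mul_pow]
    field_simp
  have h5 : (4 : ℝ) ^ n * 4 ^ n ≤ 4 ^ (2 * n + 1) := by
    rw [← pow_add, ← two_mul]; exact pow_le_pow_right₀ (by norm_num) (Nat.le_succ _)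
  calc ‖b‖ ^ 2 * ∏ k ∈ s, (x - p k) ^ 2 =
      ‖b‖ ^ 2 * (∏ k ∈ s, (x - p k) ^ 2) * ((h / 2) ^ (2 * n) * h) *
        (4 ^ n * N ^ (2 * n + 1)) := by rw [mul_assoc _ ((h / 2) ^ (2 * n) * h), h4, mul_one]
    _ ≤ 4 ^ n * J * (4 ^ n * N ^ (2 * n + 1)) := by gcongr
    _ = (4 ^ n * 4 ^ n) * (N ^ (2 * n + 1) * J) := by ring
    _ ≤ 4 ^ (2 * n + 1) * (N ^ (2 * n + 1) * J) := by gcongr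
    _ = _ := by rw [mul_pow]; ring

/-! ### The conditional variance as a squared distance in `L²(Ĝ)` -/

theorem norm_exp_I_mul_mul (t x : ℝ) : ‖Complex.exp (Complex.I * t * x)‖ = 1 := by
  rw [mul_assoc, ← Complex.ofReal_mul, Complex.norm_exp_I_mul_ofReal]

theorem HasSpectralDensity.integrable_mul_exp {G Ghat : ℝ → ℝ} (hG : HasSpectralDensity G Ghat)
    (x : ℝ) : Integrable fun t : ℝ => (Ghat t : ℂ) * Complex.exp (Complex.I * t * x) := by
  refine (hG.1.ofReal (𝕜 := ℂ)).mul_bdd (c := 1) ?_ (Eventually.of_forall fun t => ?_)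
  · exact Continuous.aestronglyMeasurable (by fun_prop)
  · rw [norm_exp_I_mul_mul]

theorem ofReal_norm_exp_sum_sq {ι : Type*} [Fintype ι] (b z : ι → ℝ) (t : ℝ) :
    ((‖∑ j, (b j : ℂ) * Complex.exp (Complex.I * t * z j)‖ ^ 2 : ℝ) : ℂ) =
      ∑ j, ∑ l, (b j * b l : ℂ) * Complex.exp (Complex.I * t * (z j - z l : ℝ)) := by
  rw [Complex.ofReal_pow, ← Complex.mul_conj', map_sum, Finset.sum_mul_sum]
  refine Finset.sum_congr rfl fun j _ => Finset.sum_congr rfl fun l _ => ?_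
  rw [map_mul, Complex.conj_ofReal, ← Complex.exp_conj, mul_mul_mul_comm, ← Complex.exp_add]
  congr 2
  simp only [map_mul, Complex.conj_I, Complex.conj_ofReal]
  push_cast
  ring

theorem HasSpectralDensity.integral_exp_sum_sq {G Ghat : ℝ → ℝ} (hG : HasSpectralDensity G Ghat)
    {ι : Type*} [Fintype ι] (b z : ι → ℝ) :
    ∫ t, Ghat t * ‖∑ j, (b j : ℂ) * Complex.exp (Complex.I * t * z j)‖ ^ 2 =
      ∑ j, ∑ l, b j * b l * G (z j - z l) := by
  apply Complex.ofReal_injective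
  rw [← integral_complex_ofReal]
  simp only [Complex.ofReal_mul, Complex.ofReal_sum, hG.2]
  have h : ∀ t : ℝ, (Ghat t : ℂ) *
      ((‖∑ j, (b j : ℂ) * Complex.exp (Complex.I * t * z j)‖ ^ 2 : ℝ) : ℂ) =
      ∑ j, ∑ l, (b j * b l : ℂ) * ((Ghat t : ℂ) * Complex.exp (Complex.I * t * (z j - z l : ℝ))) :=
    fun t => by
      rw [ofReal_norm_exp_sum_sq]
      simp only [Finset.mul_sum]
      exact Finset.sum_congr rfl fun j _ => Finset.sum_congr rfl fun l _ => by ring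
  simp only [h]
  rw [integral_finsetSum _ fun j _ => integrable_finsetSum _ fun l _ =>
    (hG.integrable_mul_exp _).const_mul _]
  refine Finset.sum_congr rfl fun j _ => ?_
  rw [integral_finsetSum _ fun l _ => (hG.integrable_mul_exp _).const_mul _]
  exact Finset.sum_congr rfl fun l _ => integral_const_mul _ _

theorem HasSpectralDensity.eq_integral_cos {G Ghat : ℝ → ℝ} (hG : HasSpectralDensity G Ghat)
    (x : ℝ) : G x = ∫ t, Ghat t * Real.cos (t * x) := by
  have h1 := congrArg Complex.re (hG.2 x)
  rw [Complex.ofReal_re, ← RCLike.re_eq_complex_re, ← integral_re (hG.integrable_mul_exp x)] at h1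
  rw [h1]
  refine integral_congr_ae (Eventually.of_forall fun t => ?_)
  simp only [RCLike.re_eq_complex_re, Complex.re_ofReal_mul]
  rw [mul_assoc, ← Complex.ofReal_mul, mul_comm Complex.I, Complex.exp_ofReal_mul_I_re]

theorem HasSpectralDensity.neg_apply {G Ghat : ℝ → ℝ} (hG : HasSpectralDensity G Ghat) (x : ℝ) :
    G (-x) = G x := by
  simp only [hG.eq_integral_cos, mul_neg, Real.cos_neg]

theorem HasSpectralDensity.integrable_exp_sum_sq {G Ghat : ℝ → ℝ} (hG : HasSpectralDensity G Ghat)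
    {ι : Type*} (s : Finset ι) (p : ι → ℝ) (c : ι → ℂ) (b : ℂ) (x : ℝ) :
    Integrable fun t : ℝ => Ghat t * ‖b * Complex.exp (Complex.I * t * x) +
      ∑ k ∈ s, c k * Complex.exp (Complex.I * t * p k)‖ ^ 2 := by
  refine hG.1.mul_bdd (c := (‖b‖ + ∑ k ∈ s, ‖c k‖) ^ 2) ?_ (Eventually.of_forall fun t => ?_)
  · exact Continuous.aestronglyMeasurable (by fun_prop)
  · rw [norm_pow, norm_norm]
    gcongr
    refine (norm_add_le _ _).trans (add_le_add ?_ ((norm_sum_le _ _).trans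
      (Finset.sum_le_sum fun k _ => ?_)))
    all_goals rw [norm_mul, norm_exp_I_mul_mul, mul_one]

theorem IsRapidlyDecaying.nonneg_ae {Ghat S : ℝ → ℝ} (hS : IsRapidlyDecaying Ghat S) :
    ∀ᵐ t : ℝ, 0 ≤ Ghat t := by
  filter_upwards [Measure.ae_ne volume 0] with t ht
  rw [hS.eq_exp t ht]; positivity

theorem IsRapidlyDecaying.differentiableAt {Ghat S : ℝ → ℝ} (hS : IsRapidlyDecaying Ghat S)
    {t : ℝ} (ht : 0 < t) : DifferentiableAt ℝ S t :=
  ((hS.contDiffOn.differentiableOn (by norm_num)) t ht).differentiableAt (Ioi_mem_nhds ht)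

theorem IsRapidlyDecaying.monotoneOn {Ghat S : ℝ → ℝ} (hS : IsRapidlyDecaying Ghat S) :
    MonotoneOn S (Ioi 0) := by
  refine monotoneOn_of_deriv_nonneg (convex_Ioi 0) hS.contDiffOn.continuousOn ?_ ?_
  · exact (hS.contDiffOn.differentiableOn (by norm_num)).mono interior_subset
  · rw [interior_Ioi]; exact hS.deriv_nonneg

theorem IsRapidlyDecaying.exp_neg_le {Ghat S : ℝ → ℝ} (hS : IsRapidlyDecaying Ghat S)
    {t : ℝ} (ht : 0 < t) (ht1 : t ≤ 1) : Real.exp (-S 1) ≤ Ghat t := by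
  rw [hS.eq_exp t ht.ne', abs_of_pos ht]
  exact Real.exp_le_exp.2 (neg_le_neg (hS.monotoneOn ht (mem_Ioi.2 one_pos) ht1))

/-- An integral against `Ĝ` dominates the integral over `(0, 1)`, where `Ĝ ≥ e^{-S(1)}`. -/
theorem IsRapidlyDecaying.mul_intervalIntegral_le {Ghat S : ℝ → ℝ} (hS : IsRapidlyDecaying Ghat S)
    {f : ℝ → ℝ} (hf : Continuous f) (hf0 : ∀ t, 0 ≤ f t) (hfi : Integrable fun t => Ghat t * f t) :
    Real.exp (-S 1) * ∫ t in (0 : ℝ)..1, f t ≤ ∫ t, Ghat t * f t := by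
  rw [intervalIntegral.integral_of_le zero_le_one, ← integral_const_mul]
  calc ∫ t in Ioc (0 : ℝ) 1, Real.exp (-S 1) * f t ≤ ∫ t in Ioc (0 : ℝ) 1, Ghat t * f t := by
        refine setIntegral_mono_on ?_ hfi.integrableOn measurableSet_Ioc fun t ht => ?_
        · exact (Continuous.integrableOn_Icc (by fun_prop)).mono_set Ioc_subset_Icc_self
        · exact mul_le_mul_of_nonneg_right (hS.exp_neg_le ht.1 ht.2) (hf0 t)
    _ ≤ _ := by
        refine setIntegral_le_integral hfi ?_
        filter_upwards [hS.nonneg_ae] with t ht using mul_nonneg ht (hf0 t)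

/-- The quadratic form `∫ |b e^{itx} - ∑ c_k e^{itp_k}|² Ĝ(t) dt`. -/
theorem HasSpectralDensity.integral_sub_exp_sum_sq {G Ghat : ℝ → ℝ}
    (hG : HasSpectralDensity G Ghat) {n : ℕ} (p c : Fin n → ℝ) (x : ℝ) :
    ∫ t, Ghat t * ‖Complex.exp (Complex.I * t * x) -
        ∑ k, (c k : ℂ) * Complex.exp (Complex.I * t * p k)‖ ^ 2 =
      G 0 - 2 * (c ⬝ᵥ crossCov (fun a b => G (a - b)) p x) +
        c ⬝ᵥ (gramMatrix (fun a b => G (a - b)) p).mulVec c := by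
  have h := hG.integral_exp_sum_sq (fun o : Option (Fin n) => o.elim 1 fun k => -c k)
    (fun o => o.elim x p)
  simp only [Fintype.sum_option, Option.elim_none, Option.elim_some, Complex.ofReal_one, one_mul,
    Complex.ofReal_neg, neg_mul, Finset.sum_neg_distrib, ← sub_eq_add_neg] at h
  rw [h]
  have h1 : ∑ k, c k * 1 * G (p k - x) = ∑ k, c k * G (x - p k) :=
    Finset.sum_congr rfl fun k _ => by rw [mul_one, ← hG.neg_apply, neg_sub]
  simp only [dotProduct, crossCov, Matrix.mulVec, gramMatrix, Matrix.of_apply, sub_self,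
    Finset.sum_sub_distrib, h1, mul_neg, Finset.sum_neg_distrib, Finset.mul_sum]
  have h2 : ∑ k, ∑ l, -(c k * c l) * G (p k - p l) =
      -∑ k, ∑ l, c k * (G (p k - p l) * c l) := by
    simp only [← Finset.sum_neg_distrib]
    exact Finset.sum_congr rfl fun k _ => Finset.sum_congr rfl fun l _ => by ring
  have h3 : ∑ k, 2 * (c k * G (x - p k)) =
      ∑ k, c k * G (x - p k) + ∑ k, c k * G (x - p k) := by
    rw [← Finset.mul_sum, two_mul]
  have h4 : ∑ k, 1 * c k * G (x - p k) = ∑ k, c k * G (x - p k) := by simp only [one_mul]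
  linarith

/-- The squared distance in `L²(Ĝ)` of `b e^{itx}` from the span of the `e^{itp_k}` is positive: it
is bounded below already by the integral over `(0, 1)`. -/
theorem sq_mul_prod_le_integral_spectral {G Ghat S : ℝ → ℝ} (hG : HasSpectralDensity G Ghat)
    (hS : IsRapidlyDecaying Ghat S) {ι : Type*} [DecidableEq ι] {p : ι → ℝ} {x : ℝ}
    {s : Finset ι} (hp : ∀ k ∈ s, |x - p k| ≤ 2) (c : ι → ℂ) (b : ℂ) :
    Real.exp (-S 1) * (‖b‖ ^ 2 * ∏ k ∈ s, (x - p k) ^ 2) ≤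
      (4 * ((s.card : ℝ) + 1)) ^ (2 * s.card + 1) *
      ∫ t, Ghat t * ‖b * Complex.exp (Complex.I * t * x) +
          ∑ k ∈ s, c k * Complex.exp (Complex.I * t * p k)‖ ^ 2 := by
  have h1 := sq_mul_prod_le_integral_exp_sum hp c b
  have h2 := hS.mul_intervalIntegral_le
    (f := fun t => ‖b * Complex.exp (Complex.I * t * x) +
          ∑ k ∈ s, c k * Complex.exp (Complex.I * t * p k)‖ ^ 2) (by fun_prop)
    (fun t => by positivity) (hG.integrable_exp_sum_sq s p c b x)
  refine (mul_le_mul_of_nonneg_left h1 (Real.exp_nonneg _)).trans ?_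
  rw [mul_left_comm]
  gcongr

theorem isUnit_det_gramMatrix {G Ghat S : ℝ → ℝ} (hG : HasSpectralDensity G Ghat)
    (hS : IsRapidlyDecaying Ghat S) {n : ℕ} {p : Fin n → ℝ} (hp : Function.Injective p)
    (hp1 : ∀ k, |p k| ≤ 1) : IsUnit (gramMatrix (fun a b => G (a - b)) p).det := by
  rw [← Matrix.isUnit_iff_isUnit_det, ← Matrix.mulVec_injective_iff_isUnit]
  refine (injective_iff_map_eq_zero (gramMatrix (fun a b => G (a - b)) p).mulVecLin).2
    fun c hc => ?_
  by_contra hne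
  obtain ⟨j, hj⟩ := Function.ne_iff.1 hne
  have h0 : ∑ k, ∑ l, c k * c l * G (p k - p l) = 0 := by
    have : c ⬝ᵥ (gramMatrix (fun a b => G (a - b)) p).mulVec c = 0 := by
      rw [Matrix.mulVecLin_apply] at hc
      rw [hc, dotProduct_zero]
    rw [← this]
    simp only [dotProduct, Matrix.mulVec, gramMatrix, Matrix.of_apply, Finset.mul_sum]
    exact Finset.sum_congr rfl fun k _ => Finset.sum_congr rfl fun l _ => by ring
  have h := sq_mul_prod_le_integral_spectral hG hS (p := p) (x := p j) (s := Finset.univ.erase j)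
    (fun k _ => (abs_sub _ _).trans (by linarith [hp1 j, hp1 k])) (fun k => (c k : ℂ)) (c j : ℂ)
  have hsum : ∀ t : ℝ, (c j : ℂ) * Complex.exp (Complex.I * t * p j) +
      ∑ k ∈ Finset.univ.erase j, (c k : ℂ) * Complex.exp (Complex.I * t * p k) =
      ∑ k, (c k : ℂ) * Complex.exp (Complex.I * t * p k) := fun t =>
    Finset.add_sum_erase _ (fun k => (c k : ℂ) * Complex.exp (Complex.I * t * p k))
      (Finset.mem_univ j)
  simp only [hsum] at h
  rw [hG.integral_exp_sum_sq, h0, mul_zero] at h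
  refine h.not_gt (mul_pos (Real.exp_pos _) (mul_pos ?_ (Finset.prod_pos fun k hk => ?_)))
  · have : (c j : ℂ) ≠ 0 := by exact_mod_cast hj
    positivity
  · have : p j - p k ≠ 0 := sub_ne_zero.2 fun e => (Finset.ne_of_mem_erase hk) (hp e).symm
    positivity

/-- The conditional variance is the value of the quadratic form at its minimizer. -/
theorem HasSpectralDensity.condVar_eq {G Ghat : ℝ → ℝ}
    (hG : HasSpectralDensity G Ghat) {n : ℕ} {p : Fin n → ℝ}
    (hp : IsUnit (gramMatrix (fun a b => G (a - b)) p).det) (x : ℝ) :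
    ∃ c : Fin n → ℝ, condVar (fun a b => G (a - b)) p x =
      ∫ t, Ghat t * ‖Complex.exp (Complex.I * t * x) -
        ∑ k, (c k : ℂ) * Complex.exp (Complex.I * t * p k)‖ ^ 2 := by
  set A := gramMatrix (fun a b => G (a - b)) p with hA
  set g := crossCov (fun a b => G (a - b)) p x with hg
  refine ⟨A⁻¹.mulVec g, ?_⟩
  rw [hG.integral_sub_exp_sum_sq, ← hA, ← hg, Matrix.mulVec_mulVec, Matrix.mul_nonsing_inv _ hp,
    Matrix.one_mulVec, condVar, ← hA, ← hg, dotProduct_comm g]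
  simp only [sub_self]
  ring

theorem HasSpectralDensity.condVar_le {G Ghat S : ℝ → ℝ}
    (hG : HasSpectralDensity G Ghat) (hS : IsRapidlyDecaying Ghat S) {n : ℕ} {p : Fin n → ℝ}
    (hp : IsUnit (gramMatrix (fun a b => G (a - b)) p).det) (x : ℝ) (c : Fin n → ℝ) :
    condVar (fun a b => G (a - b)) p x ≤
      ∫ t, Ghat t * ‖Complex.exp (Complex.I * t * x) -
        ∑ k, (c k : ℂ) * Complex.exp (Complex.I * t * p k)‖ ^ 2 := by
  rw [hG.integral_sub_exp_sum_sq]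
  set A := gramMatrix (fun a b => G (a - b)) p with hA
  set g := crossCov (fun a b => G (a - b)) p x with hg
  set d := A⁻¹.mulVec g with hd
  have hAd : A.mulVec d = g := by
    rw [hd, Matrix.mulVec_mulVec, Matrix.mul_nonsing_inv _ hp, Matrix.one_mulVec]
  have hT : A.transpose = A := by
    ext k l
    simp only [hA, gramMatrix, Matrix.transpose_apply, Matrix.of_apply]
    rw [← hG.neg_apply, neg_sub]
  have hpos : 0 ≤ (c - d) ⬝ᵥ A.mulVec (c - d) := by
    have h := hG.integral_exp_sum_sq (c - d) p
    have h0 : 0 ≤ ∫ t, Ghat t *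
        ‖∑ j, (((c - d) j : ℝ) : ℂ) * Complex.exp (Complex.I * t * p j)‖ ^ 2 :=
      integral_nonneg_of_ae (by filter_upwards [hS.nonneg_ae] with t ht using by positivity)
    rw [h] at h0
    convert h0 using 1
    simp only [dotProduct, Matrix.mulVec, hA, gramMatrix, Matrix.of_apply, Finset.mul_sum]
    exact Finset.sum_congr rfl fun k _ => Finset.sum_congr rfl fun l _ => by ring
  have hdc : d ⬝ᵥ A.mulVec c = c ⬝ᵥ g := by
    rw [Matrix.dotProduct_mulVec, ← Matrix.mulVec_transpose, hT, hAd, dotProduct_comm]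
  rw [Matrix.mulVec_sub, dotProduct_sub, sub_dotProduct, sub_dotProduct, hAd, hdc] at hpos
  have : condVar (fun a b => G (a - b)) p x = G 0 - d ⬝ᵥ g := by
    rw [condVar, ← hA, ← hg, ← hd, dotProduct_comm g, sub_self]
  linarith

theorem prod_le_condVar {G Ghat S : ℝ → ℝ} (hG : HasSpectralDensity G Ghat)
    (hS : IsRapidlyDecaying Ghat S) {n : ℕ} {p : Fin n → ℝ} (hp : Function.Injective p)
    (hp1 : ∀ k, |p k| ≤ 1) {x : ℝ} (hx : |x| ≤ 1) :
    Real.exp (-S 1) * ∏ k, (x - p k) ^ 2 ≤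
      (4 * ((n : ℝ) + 1)) ^ (2 * n + 1) * condVar (fun a b => G (a - b)) p x := by
  obtain ⟨c, hc⟩ := hG.condVar_eq (isUnit_det_gramMatrix hG hS hp hp1) x
  have h := sq_mul_prod_le_integral_spectral hG hS (p := p) (x := x) (s := Finset.univ)
    (fun k _ => (abs_sub _ _).trans (by linarith [hp1 k])) (fun k => -(c k : ℂ)) 1
  rw [hc]
  simpa [← sub_eq_add_neg] using h

theorem condVar_apply_le_zero {G Ghat S : ℝ → ℝ} (hG : HasSpectralDensity G Ghat)
    (hS : IsRapidlyDecaying Ghat S) {n : ℕ} {p : Fin n → ℝ} (hp : Function.Injective p)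
    (hp1 : ∀ k, |p k| ≤ 1) (j : Fin n) : condVar (fun a b => G (a - b)) p (p j) ≤ 0 := by
  refine (hG.condVar_le hS (isUnit_det_gramMatrix hG hS hp hp1) _ (Pi.single j 1)).trans_eq ?_
  have : ∀ t : ℝ, Complex.exp (Complex.I * t * p j) - ∑ k,
      (((Pi.single j 1 : Fin n → ℝ) k : ℝ) : ℂ) * Complex.exp (Complex.I * t * p k) = 0 := fun t => by
    rw [Finset.sum_eq_single j] <;> simp +contextual
  simp [this]

/-- The conditional variance is bounded by the squared error of polynomial interpolation. -/
theorem condVar_le_moment {G Ghat S : ℝ → ℝ} (hG : HasSpectralDensity G Ghat)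
    (hS : IsRapidlyDecaying Ghat S) {n : ℕ} {p : Fin n → ℝ} (hp : Function.Injective p)
    (hp1 : ∀ k, |p k| ≤ 1) (hm : Integrable fun t => t ^ (2 * n) * Ghat t) (x : ℝ) :
    condVar (fun a b => G (a - b)) p x ≤
      2 / (n.factorial : ℝ) ^ 2 * (∫ t, t ^ (2 * n) * Ghat t) * ∏ k, (x - p k) ^ 2 := by
  refine (hG.condVar_le hS (isUnit_det_gramMatrix hG hS hp hp1) _
    (fun i => (Lagrange.basis Finset.univ p i).eval x)).trans ?_
  rw [mul_right_comm, ← integral_const_mul]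
  refine integral_mono_of_nonneg ?_ (hm.const_mul _) ?_
  · filter_upwards [hS.nonneg_ae] with t ht using by positivity
  · filter_upwards [hS.nonneg_ae] with t ht
    refine (mul_le_mul_of_nonneg_left (norm_exp_sub_sum_lagrange_sq_le t hp x) ht).trans_eq ?_
    ring

/-! ### Moments of the spectral density and the Legendre transform -/

namespace IsRapidlyDecaying

variable {Ghat S : ℝ → ℝ}

theorem contDiffOn_deriv (hS : IsRapidlyDecaying Ghat S) : ContDiffOn ℝ 1 (deriv S) (Ioi 0) :=
  ((contDiffOn_succ_iff_deriv_of_isOpen (n := 1) isOpen_Ioi).1 hS.contDiffOn).2.2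

theorem monotoneOn_deriv (hS : IsRapidlyDecaying Ghat S) : MonotoneOn (deriv S) (Ioi 0) := by
  refine monotoneOn_of_deriv_nonneg (convex_Ioi 0) hS.contDiffOn_deriv.continuousOn ?_ ?_
  · exact (hS.contDiffOn_deriv.differentiableOn (by norm_num)).mono interior_subset
  · rw [interior_Ioi]; exact hS.deriv_deriv_nonneg

theorem tangent_le (hS : IsRapidlyDecaying Ghat S) {a t : ℝ} (ha : 0 < a) (ht : 0 < t) :
    S a + deriv S a * (t - a) ≤ S t := by
  have hconv : ConvexOn ℝ (Ioi 0) S := by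
    refine MonotoneOn.convexOn_of_deriv (convex_Ioi 0) hS.contDiffOn.continuousOn ?_ ?_
    · exact (hS.contDiffOn.differentiableOn (by norm_num)).mono interior_subset
    · rw [interior_Ioi]; exact hS.monotoneOn_deriv
  have hd := (hS.differentiableAt ha).hasDerivAt
  rcases lt_trichotomy a t with h | rfl | h
  · have h1 := hconv.le_slope_of_hasDerivAt ha ht h hd
    rw [slope_def_field, le_div_iff₀ (by linarith)] at h1
    linarith
  · simp
  · have h1 := hconv.slope_le_of_hasDerivAt ht ha h hd
    rw [slope_def_field, div_le_iff₀ (by linarith)] at h1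
    linarith

/-- The critical point of `q log t - S t`, at which the Legendre transform is attained. -/
theorem exists_mul_deriv_eq (hS : IsRapidlyDecaying Ghat S) {q : ℝ} (hq : 0 < q) :
    ∃ a, 0 < a ∧ a * deriv S a = q := by
  have hd1 := hS.deriv_nonneg 1 one_pos
  obtain ⟨v, hv1, hv⟩ := ((eventually_ge_atTop (1 : ℝ)).and
    (hS.tendsto_deriv.eventually_ge_atTop q)).exists
  set u := min 1 (q / (deriv S 1 + 1)) with hu
  have hu0 : 0 < u := lt_min one_pos (by positivity)
  have hu1 : u ≤ 1 := min_le_left _ _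
  have hcont : ContinuousOn (fun a => a * deriv S a) (Icc u v) :=
    (continuousOn_id.mul hS.contDiffOn_deriv.continuousOn).mono fun a ha => hu0.trans_le ha.1
  have h1 : u * deriv S u ≤ q := by
    have h2 : deriv S u ≤ deriv S 1 := hS.monotoneOn_deriv hu0 (mem_Ioi.2 one_pos) hu1
    have h3 : u * (deriv S 1 + 1) ≤ q := by
      rw [← le_div_iff₀ (by positivity)]; exact min_le_right _ _
    nlinarith
  have h2 : q ≤ v * deriv S v := by nlinarith
  obtain ⟨a, ha, haq⟩ := intermediate_value_Icc (hu1.trans hv1) hcont ⟨h1, h2⟩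
  exact ⟨a, hu0.trans_le ha.1, haq⟩

theorem mul_sub_le_of_tangent (hS : IsRapidlyDecaying Ghat S) {q b : ℝ} (hq : 0 < q) (hb : 0 < b)
    (hA : 0 < deriv S b) (s : ℝ) :
    q * s - S (Real.exp s) ≤ q * (Real.log (q / deriv S b) - 1) - S b + deriv S b * b := by
  have h1 := hS.tangent_le hb (Real.exp_pos s)
  set A := deriv S b with hAdef
  have h2 := Real.add_one_le_exp (s - Real.log (q / A))
  rw [Real.exp_sub, Real.exp_log (by positivity), div_div_eq_mul_div, le_div_iff₀ hq] at h2
  linarith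

theorem bddAbove_range (hS : IsRapidlyDecaying Ghat S) {q : ℝ} (hq : 0 < q) :
    BddAbove (range fun s => q * s - S (Real.exp s)) := by
  obtain ⟨a, ha, haq⟩ := hS.exists_mul_deriv_eq hq
  refine ⟨_, forall_mem_range.2 fun s => hS.mul_sub_le_of_tangent hq ha ?_ s⟩
  by_contra hneg
  nlinarith [hS.deriv_nonneg a ha]

theorem le_legendre (hS : IsRapidlyDecaying Ghat S) {q t : ℝ} (hq : 0 < q) (ht : 0 < t) :
    q * Real.log t - S t ≤ legendre (fun s => S (Real.exp s)) q := by
  have h := le_ciSup (hS.bddAbove_range hq) (Real.log t)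
  simp only [Real.exp_log ht] at h
  exact h

theorem legendre_le (hS : IsRapidlyDecaying Ghat S) {q b : ℝ} (hq : 0 < q) (hb : 0 < b)
    (hA : 0 < deriv S b) : legendre (fun s => S (Real.exp s)) q ≤
      q * (Real.log (q / deriv S b) - 1) - S b + deriv S b * b :=
  ciSup_le (hS.mul_sub_le_of_tangent hq hb hA)

/-- `F(K) / K → -∞`. -/
theorem eventually_rate_le (hS : IsRapidlyDecaying Ghat S) (M : ℝ) :
    ∀ᶠ K : ℕ in atTop, rate S K ≤ -M * K := by
  obtain ⟨b, hb1, hb⟩ := ((eventually_ge_atTop (1 : ℝ)).and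
    (hS.tendsto_deriv.eventually_ge_atTop (Real.exp (|M| + 2)))).exists
  have hA : 0 < deriv S b := (Real.exp_pos _).trans_le hb
  filter_upwards [eventually_ge_atTop 1,
    tendsto_natCast_atTop_atTop.eventually_ge_atTop (-S b + deriv S b * b)] with K hK hKC
  have hK1 : (1 : ℝ) ≤ K := by exact_mod_cast hK
  have hq : (0 : ℝ) < 2 * K + 1 := by positivity
  have h1 := hS.legendre_le hq (one_pos.trans_le hb1) hA
  have h2 : Real.log ((2 * K + 1) / deriv S b) ≤ 2 + Real.log K - (|M| + 2) := by
    rw [Real.log_div hq.ne' hA.ne']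
    have h3 : Real.log (2 * K + 1) ≤ 2 + Real.log K := by
      have h4 : Real.log (2 * K + 1) ≤ Real.log (3 * K) :=
        Real.log_le_log hq (by linarith)
      rw [Real.log_mul (by norm_num) (by positivity)] at h4
      linarith [Real.log_le_sub_one_of_pos (show (0 : ℝ) < 3 by norm_num)]
    have h5 := (Real.le_log_iff_exp_le hA).2 hb
    linarith
  have h6 : (2 * K + 1) * (Real.log ((2 * K + 1) / deriv S b) - 1) ≤
      (2 * K + 1) * (Real.log K - |M| - 1) := by
    refine mul_le_mul_of_nonneg_left ?_ hq.le
    linarith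
  have h7 : M * K ≤ |M| * (2 * K + 1) := by
    nlinarith [le_abs_self M, abs_nonneg M]
  rw [rate]
  linarith

theorem integrable_moment_and_le (hS : IsRapidlyDecaying Ghat S)
    (hm : AEStronglyMeasurable Ghat) (n : ℕ) :
    Integrable (fun t => t ^ (2 * n) * Ghat t) ∧ ∫ t, t ^ (2 * n) * Ghat t ≤
      2 * Real.exp (2 * n + 1 + legendre (fun s => S (Real.exp s)) (2 * n + 1)) := by
  set q : ℝ := 2 * n + 1 with hq
  have hq0 : 0 < q := by positivity
  obtain ⟨a, ha, haq⟩ := hS.exists_mul_deriv_eq hq0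
  set r := q / a with hr
  have hr0 : 0 < r := by positivity
  have hrS : deriv S a = r := by rw [hr, ← haq]; field_simp
  -- the tangent line of `S` at the critical point dominates the density by an exponential one
  let f : ℝ → ℝ := fun t => Real.exp (q - S a) * (t ^ (q - 1) * Real.exp (-(r * t)))
  have hint : ∫ t in Ioi (0 : ℝ), f t = Real.exp (q - S a) * ((a / q) ^ (2 * n + 1) *
      (2 * n).factorial) := by
    rw [integral_const_mul, Real.integral_rpow_mul_exp_neg_mul_Ioi hq0 hr0]
    congr 2
    · rw [hr, one_div_div, hq, ← Real.rpow_natCast]; push_cast; rfl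
    · rw [hq, ← Real.Gamma_nat_eq_factorial]; push_cast; rfl
  have habs := integral_comp_abs (f := f)
  rw [hint] at habs
  have hfi : Integrable fun t => f |t| := by
    by_contra h
    rw [integral_undef h] at habs
    have : (0 : ℝ) < 2 * (Real.exp (q - S a) * ((a / q) ^ (2 * n + 1) * (2 * n).factorial)) := by
      positivity
    linarith
  have hle : ∀ t : ℝ, t ≠ 0 → t ^ (2 * n) * Ghat t ≤ f |t| := fun t ht => by
    have ht0 : 0 < |t| := abs_pos.2 ht
    have h1 := hS.tangent_le ha ht0
    rw [hrS] at h1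
    have h2 : r * a = q := by rw [hr]; field_simp
    have h3 : |t| ^ (q - 1) = t ^ (2 * n) := by
      rw [hq, add_sub_cancel_right, ← (even_two_mul n).pow_abs, ← Real.rpow_natCast]
      push_cast; rfl
    simp only [f]
    rw [h3, hS.eq_exp t ht, mul_left_comm, ← Real.exp_add]
    refine mul_le_mul_of_nonneg_left (Real.exp_le_exp.2 ?_) ((even_two_mul n).pow_nonneg t)
    linarith
  have hle' : ∀ᵐ t : ℝ, t ^ (2 * n) * Ghat t ≤ f |t| := by
    filter_upwards [Measure.ae_ne volume 0] with t ht using hle t ht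
  have hnn : ∀ᵐ t : ℝ, 0 ≤ t ^ (2 * n) * Ghat t := by
    filter_upwards [hS.nonneg_ae] with t ht using mul_nonneg ((even_two_mul n).pow_nonneg t) ht
  refine ⟨hfi.mono' ((Continuous.aestronglyMeasurable (by fun_prop)).mul hm) ?_, ?_⟩
  · filter_upwards [hle', hnn] with t h1 h2
    rwa [Real.norm_of_nonneg h2]
  · refine (integral_mono_of_nonneg hnn hfi hle').trans ?_
    rw [habs]
    refine mul_le_mul_of_nonneg_left ?_ zero_le_two
    have h1 := hS.le_legendre hq0 ha
    have h2 : ((2 * n).factorial : ℝ) ≤ q ^ (2 * n + 1) := by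
      have h3 : ((2 * n).factorial : ℝ) ≤ ((2 * n : ℕ) : ℝ) ^ (2 * n) := by
        exact_mod_cast Nat.factorial_le_pow _
      refine h3.trans ?_
      have hq1 : 1 ≤ q := by rw [hq]; linarith [Nat.cast_nonneg (α := ℝ) n]
      refine le_trans (pow_le_pow_left₀ (by positivity) ?_ _)
        (pow_le_pow_right₀ hq1 (Nat.le_succ _))
      rw [hq]; push_cast; linarith
    have h4 : a ^ (2 * n + 1) = Real.exp (q * Real.log a) := by
      rw [mul_comm q, Real.exp_mul, Real.exp_log ha, ← Real.rpow_natCast, hq]; push_cast; rfl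
    calc Real.exp (q - S a) * ((a / q) ^ (2 * n + 1) * (2 * n).factorial)
        ≤ Real.exp (q - S a) * ((a / q) ^ (2 * n + 1) * q ^ (2 * n + 1)) := by gcongr
      _ = Real.exp (q + (q * Real.log a - S a)) := by
          rw [← mul_pow, div_mul_cancel₀ _ hq0.ne', h4, ← Real.exp_add]; ring_nf
      _ ≤ _ := Real.exp_le_exp.2 (by linarith)

end IsRapidlyDecaying

theorem condVar_le_exp_rate {G Ghat S : ℝ → ℝ} (hG : HasSpectralDensity G Ghat)
    (hS : IsRapidlyDecaying Ghat S) {n : ℕ} (hn : 1 ≤ n) {p : Fin n → ℝ}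
    (hp : Function.Injective p) (hp1 : ∀ k, |p k| ≤ 1) (x : ℝ) :
    condVar (fun a b => G (a - b)) p x ≤ Real.exp (rate S n + 8 * n) * ∏ k, (x - p k) ^ 2 := by
  obtain ⟨hm, hle⟩ := hS.integrable_moment_and_le hG.1.1 n
  refine (condVar_le_moment hG hS hp hp1 hm x).trans ?_
  refine mul_le_mul_of_nonneg_right ?_ (Finset.prod_nonneg fun k _ => by positivity)
  set L := legendre (fun s => S (Real.exp s)) (2 * n + 1) with hL
  have hn0 : (0 : ℝ) < n := by exact_mod_cast hn
  have hn1 : (1 : ℝ) ≤ n := by exact_mod_cast hn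
  have hfac : (0 : ℝ) < n.factorial := by exact_mod_cast n.factorial_pos
  have h1 : 1 / (n.factorial : ℝ) ≤ Real.exp (n - n * Real.log n) := by
    have h2 := Real.pow_div_factorial_le_exp _ hn0.le n
    have h3 : (n : ℝ) ^ n = Real.exp (n * Real.log n) := by
      rw [mul_comm (n : ℝ), Real.exp_mul, Real.exp_log hn0, Real.rpow_natCast]
    rw [Real.exp_sub, le_div_iff₀ (Real.exp_pos _), ← h3, one_div_mul_eq_div]
    exact h2
  have h4 : (4 : ℝ) ≤ Real.exp 3 := by linarith [Real.add_one_le_exp (3 : ℝ)]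
  have h5 : (n : ℝ) ≤ Real.exp n / Real.exp 1 := by
    rw [← Real.exp_sub]; linarith [Real.add_one_le_exp ((n : ℝ) - 1)]
  calc 2 / (n.factorial : ℝ) ^ 2 * ∫ t, t ^ (2 * n) * Ghat t
      ≤ 2 / (n.factorial : ℝ) ^ 2 * (2 * Real.exp (2 * n + 1 + L)) := by gcongr
    _ = 4 * (1 / (n.factorial : ℝ)) ^ 2 * Real.exp (2 * n + 1 + L) := by ring
    _ ≤ Real.exp 3 * Real.exp (n - n * Real.log n) ^ 2 * Real.exp (2 * n + 1 + L) := by gcongr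
    _ = Real.exp (L - (2 * n + 1) * Real.log n + 4 * n + 4) * Real.exp (Real.log n) := by
        rw [← Real.exp_nat_mul, ← Real.exp_add, ← Real.exp_add, ← Real.exp_add]
        congr 1; push_cast; ring
    _ ≤ Real.exp (L - (2 * n + 1) * Real.log n + 4 * n + 4) * (Real.exp n / Real.exp 1) := by
        rw [Real.exp_log hn0]; gcongr
    _ = Real.exp (rate S n + 5 * n + 3) := by
        rw [← Real.exp_sub, ← Real.exp_add, rate]; congr 1; ring
    _ ≤ _ := Real.exp_le_exp.2 (by linarith)

/-! ### The gap `G(0) - G(x)` -/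

theorem HasSpectralDensity.integrable_mul_cos {G Ghat : ℝ → ℝ} (hG : HasSpectralDensity G Ghat)
    (x : ℝ) : Integrable fun t => Ghat t * Real.cos (t * x) :=
  hG.1.mul_bdd (c := 1) (Continuous.aestronglyMeasurable (by fun_prop))
    (Eventually.of_forall fun _ => Real.abs_cos_le_one _)

theorem HasSpectralDensity.gap_eq_integral {G Ghat : ℝ → ℝ} (hG : HasSpectralDensity G Ghat)
    (x : ℝ) : Integrable (fun t => Ghat t * (1 - Real.cos (t * x))) ∧
      G 0 - G x = ∫ t, Ghat t * (1 - Real.cos (t * x)) := by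
  have h : ∀ t, Ghat t * (1 - Real.cos (t * x)) =
      Ghat t * Real.cos (t * 0) - Ghat t * Real.cos (t * x) := fun t => by
    rw [mul_zero, Real.cos_zero]; ring
  simp only [h]
  refine ⟨(hG.integrable_mul_cos 0).sub (hG.integrable_mul_cos x), ?_⟩
  rw [integral_sub (hG.integrable_mul_cos 0) (hG.integrable_mul_cos x), ← hG.eq_integral_cos,
    ← hG.eq_integral_cos]

theorem sq_le_gap {G Ghat S : ℝ → ℝ} (hG : HasSpectralDensity G Ghat)
    (hS : IsRapidlyDecaying Ghat S) {x : ℝ} (hx : |x| ≤ 1) :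
    Real.exp (-S 1) / 24 * x ^ 2 ≤ G 0 - G x := by
  obtain ⟨hi, he⟩ := hG.gap_eq_integral x
  rw [he]
  refine le_trans ?_ (hS.mul_intervalIntegral_le (by fun_prop)
    (fun t => sub_nonneg.2 (Real.cos_le_one _)) hi)
  rw [div_mul_eq_mul_div, mul_div_assoc]
  refine mul_le_mul_of_nonneg_left ?_ (Real.exp_nonneg _)
  have h1 : ∫ t in (0 : ℝ)..1, x ^ 2 / 8 * t ^ 2 = x ^ 2 / 24 := by
    rw [intervalIntegral.integral_const_mul, integral_pow]
    norm_num
    ring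
  rw [← h1]
  refine intervalIntegral.integral_mono_on zero_le_one ?_ ?_ fun t ht => ?_
  · exact Continuous.intervalIntegrable (by fun_prop) _ _
  · exact Continuous.intervalIntegrable (by fun_prop) _ _
  · have h2 : |t * x| ≤ 1 := by
      rw [abs_mul, abs_of_nonneg ht.1]
      exact mul_le_one₀ ht.2 (abs_nonneg _) hx
    have h3 := Real.cos_le_one_sub_mul_cos_sq (h2.trans (by linarith [Real.pi_gt_three]))
    have h4 : 1 / 8 ≤ 2 / Real.pi ^ 2 := by
      rw [div_le_div_iff₀ (by norm_num) (by positivity)]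
      nlinarith [Real.pi_le_four, Real.pi_pos]
    nlinarith [mul_le_mul_of_nonneg_right h4 (sq_nonneg (t * x))]

theorem exists_gap_le_sq {G Ghat S : ℝ → ℝ} (hG : HasSpectralDensity G Ghat)
    (hS : IsRapidlyDecaying Ghat S) : ∃ C, 1 ≤ C ∧ ∀ x, G 0 - G x ≤ C * x ^ 2 := by
  refine ⟨max 1 (∫ t, t ^ (2 * 1) * Ghat t), le_max_left _ _, fun x => ?_⟩
  have hm := (hS.integrable_moment_and_le hG.1.1 1).1
  rw [(hG.gap_eq_integral x).2]
  refine le_trans ?_ (mul_le_mul_of_nonneg_right (le_max_right 1 _) (sq_nonneg x))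
  rw [← integral_mul_const]
  refine integral_mono_ae (hG.gap_eq_integral x).1 (hm.mul_const _) ?_
  filter_upwards [hS.nonneg_ae] with t ht
  have h1 := Real.one_sub_sq_div_two_le_cos (x := t * x)
  have h2 : 1 - Real.cos (t * x) ≤ (t * x) ^ 2 := by nlinarith [sq_nonneg (t * x)]
  refine (mul_le_mul_of_nonneg_left h2 ht).trans_eq ?_
  ring

/-! ### The expected improvement of a Gaussian variable -/

theorem integral_improvement_le (m μ : ℝ) (v : NNReal) {l : ℝ} (hl : 0 < l) :
    ∫ t, (m - min m t) ∂(gaussianReal μ v) ≤ Real.exp (-l * (μ - m) + v * l ^ 2 / 2) / l := by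
  have h1 : ∀ t, m - min m t ≤ Real.exp (l * m) / l * Real.exp (-l * t) := fun t => by
    rw [div_mul_eq_mul_div, ← Real.exp_add, le_div_iff₀ hl]
    rcases le_total m t with h | h
    · rw [min_eq_left h, sub_self, zero_mul]; positivity
    · rw [min_eq_right h]
      linarith [Real.add_one_le_exp (l * m + -l * t)]
  refine (integral_mono_of_nonneg (Eventually.of_forall fun t => sub_nonneg.2 (min_le_left _ _))
    ((integrable_exp_mul_gaussianReal (-l)).const_mul _) (Eventually.of_forall h1)).trans_eq ?_
  have h2 := congrFun (mgf_fun_id_gaussianReal (μ := μ) (v := v)) (-l)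
  rw [mgf] at h2
  rw [integral_const_mul, h2, div_mul_eq_mul_div, ← Real.exp_add]
  congr 2
  ring

/-- The probability that a standard normal variable is at most `-2`. -/
noncomputable def normalTail : ℝ := (gaussianReal 0 1).real (Iic (-2))

theorem normalTail_pos : 0 < normalTail := by
  have h : gaussianReal 0 1 (Iic (-2)) ≠ 0 := fun h => by
    have := gaussianReal_absolutelyContinuous' 0 one_ne_zero h
    simp at this
  exact ENNReal.toReal_pos h (measure_ne_top _ _)

theorem le_integral_improvement {m μ s : ℝ} (hs : 0 ≤ s) (hm : μ - m ≤ s) {v : NNReal}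
    (hv : (v : ℝ) = s ^ 2) :
    normalTail * s ≤ ∫ t, (m - min m t) ∂(gaussianReal μ v) := by
  have hmap : gaussianReal μ v = (gaussianReal 0 1).map (fun z => s * z + μ) := by
    have : (fun z : ℝ => s * z + μ) = (fun z => z + μ) ∘ fun z => s * z := rfl
    rw [this, ← Measure.map_map (by fun_prop) (by fun_prop), gaussianReal_map_const_mul,
      gaussianReal_map_add_const]
    congr 1
    · simp
    · ext; simp [hv]
  have hint : Integrable (fun z : ℝ => m - min m (s * z + μ)) (gaussianReal 0 1) := by
    have hid : Integrable (fun z : ℝ => z) (gaussianReal 0 1) :=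
      (memLp_id_gaussianReal 1).integrable le_rfl
    exact (integrable_const m).sub ((integrable_const m).inf ((hid.const_mul s).add
      (integrable_const μ)))
  rw [hmap, integral_map (by fun_prop) (Continuous.aestronglyMeasurable (by fun_prop))]
  calc normalTail * s = ∫ _ in Iic (-2 : ℝ), s ∂(gaussianReal 0 1) := by
        rw [setIntegral_const, smul_eq_mul, normalTail]
    _ ≤ ∫ z in Iic (-2 : ℝ), (m - min m (s * z + μ)) ∂(gaussianReal 0 1) := by
        refine setIntegral_mono_on (integrable_const _).integrableOn hint.integrableOn
          measurableSet_Iic fun z hz => ?_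
        have : s * z ≤ s * (-2) := mul_le_mul_of_nonneg_left hz hs
        rw [min_eq_right (by linarith)]
        linarith
    _ ≤ _ := setIntegral_le_integral hint
        (Eventually.of_forall fun z => sub_nonneg.2 (min_le_left _ _))

/-- For `f = -G` and observations that include the origin, `f` is itself the conditional mean,
and the best observed value is the global minimum `-G(0)`. -/
theorem expectedImprovement_neg_eq {G Ghat S : ℝ → ℝ} (hG : HasSpectralDensity G Ghat)
    (hS : IsRapidlyDecaying Ghat S) {n : ℕ} {p : Fin n → ℝ} (hp : Function.Injective p)
    (hp1 : ∀ k, |p k| ≤ 1) {j : Fin n} (hj : p j = 0) (x : ℝ) :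
    expectedImprovement (fun a b => G (a - b)) p (fun k => -G (p k)) x =
      ∫ t, (-G 0 - min (-G 0) t)
        ∂(gaussianReal (-G x) (condVar (fun a b => G (a - b)) p x).toNNReal) := by
  have hinf : (⨅ k, -G (p k)) = -G 0 := by
    have : Nonempty (Fin n) := ⟨j⟩
    have hle : ∀ k, -G 0 ≤ -G (p k) := fun k => by
      have := sq_le_gap hG hS (hp1 k)
      have h2 : 0 ≤ Real.exp (-S 1) / 24 * p k ^ 2 := by positivity
      linarith
    refine le_antisymm ?_ (le_ciInf hle)
    have h3 := ciInf_le (f := fun k => -G (p k)) ⟨-G 0, forall_mem_range.2 hle⟩ j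
    rwa [hj] at h3
  have hmean : condMean (fun a b => G (a - b)) p x (fun k => -G (p k)) = -G x := by
    have h1 : (fun k => -G (p k)) =
        (gramMatrix (fun a b => G (a - b)) p).mulVec (-Pi.single j 1) := by
      ext k
      rw [Matrix.mulVec_neg, Matrix.mulVec_single_one]
      simp [gramMatrix, hj]
    rw [condMean, h1, Matrix.mulVec_mulVec, Matrix.nonsing_inv_mul _
      (isUnit_det_gramMatrix hG hS hp hp1), Matrix.one_mulVec]
    simp [crossCov, hj]
  rw [expectedImprovement, hinf]
  change ∫ t, _ ∂(gaussianReal (condMean _ p x _) _) = _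
  rw [hmean]

section

variable {G Ghat S : ℝ → ℝ} (hG : HasSpectralDensity G Ghat) (hS : IsRapidlyDecaying Ghat S)
  {n : ℕ} {p : Fin n → ℝ} (hp : Function.Injective p) (hp1 : ∀ k, |p k| ≤ 1) {j : Fin n}
  (hj : p j = 0)

include hG hS hp hp1 hj

theorem expectedImprovement_neg_le {x l w : ℝ} (hl : 0 < l) (hw0 : 0 ≤ w)
    (hw : condVar (fun a b => G (a - b)) p x ≤ w) :
    expectedImprovement (fun a b => G (a - b)) p (fun k => -G (p k)) x ≤
      Real.exp (-l * (G 0 - G x) + w * l ^ 2 / 2) / l := by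
  rw [expectedImprovement_neg_eq hG hS hp hp1 hj]
  refine (integral_improvement_le _ _ _ hl).trans ?_
  have h : ((condVar (fun a b => G (a - b)) p x).toNNReal : ℝ) ≤ w := by
    rw [Real.coe_toNNReal']; exact max_le hw hw0
  have h2 := mul_le_mul_of_nonneg_right h (sq_nonneg l)
  gcongr Real.exp ?_ / l
  rw [neg_sub_neg]
  linarith

theorem le_expectedImprovement_neg {x s : ℝ}
    (hsv : s ^ 2 ≤ condVar (fun a b => G (a - b)) p x) (hx : G 0 - G x ≤ s) :
    normalTail * s ≤
      expectedImprovement (fun a b => G (a - b)) p (fun k => -G (p k)) x := by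
  rw [expectedImprovement_neg_eq hG hS hp hp1 hj]
  have h0 := (sq_nonneg s).trans hsv
  have hs' : s ≤ √(condVar (fun a b => G (a - b)) p x) := Real.le_sqrt_of_sq_le hsv
  refine (mul_le_mul_of_nonneg_left hs' normalTail_pos.le).trans ?_
  refine le_integral_improvement (Real.sqrt_nonneg _) ?_ ?_
  · linarith
  · rw [Real.coe_toNNReal _ h0, Real.sq_sqrt h0]

theorem expectedImprovement_neg_apply_le (i : Fin n) :
    expectedImprovement (fun a b => G (a - b)) p (fun k => -G (p k)) (p i) ≤ 0 := by
  refine le_of_forall_pos_le_add fun ε hε => ?_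
  refine (expectedImprovement_neg_le hG hS hp hp1 hj (one_div_pos.2 hε) le_rfl
    (condVar_apply_le_zero hG hS hp hp1 i)).trans ?_
  have hgap : 0 ≤ G 0 - G (p i) :=
    le_trans (by positivity) (sq_le_gap hG hS (hp1 i))
  rw [zero_mul, zero_div, add_zero, zero_add, div_div_eq_mul_div, div_one]
  refine mul_le_of_le_one_left hε.le (Real.exp_le_one_iff.2 ?_)
  rw [neg_mul]
  exact neg_nonpos.2 (by positivity)

end

/-! ### One step of the algorithm -/

theorem exp_neg_abs_log_mul_sq_le {c m : ℝ} (hc : 0 < c) (hm : 1 ≤ m) :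
    Real.exp (-|Real.log c| * m ^ 2) ≤ c := by
  rw [← Real.le_log_iff_exp_le hc]
  nlinarith [neg_abs_le (Real.log c), abs_nonneg (Real.log c), one_le_pow₀ hm (n := 2)]

/-- The points `p 0 = 0, …, p n` are pairwise distinct and lie in `[-1, 1]`. -/
structure IsAdmissible {n : ℕ} (p : Fin (n + 1) → ℝ) : Prop where
  injective : Function.Injective p
  abs_le : ∀ k, |p k| ≤ 1
  zero : p 0 = 0

section

variable {G Ghat S : ℝ → ℝ}

theorem exists_exp_mul_prod_le_condVar (hG : HasSpectralDensity G Ghat)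
    (hS : IsRapidlyDecaying Ghat S) : ∃ B : ℝ, 8 ≤ B ∧ ∀ (n : ℕ) (p : Fin (n + 1) → ℝ),
      IsAdmissible p → ∀ x, |x| ≤ 1 →
        Real.exp (-B * (n + 2) ^ 2) ^ 2 * 4 ^ n * ∏ k, (x - p k) ^ 2 ≤
          condVar (fun a b => G (a - b)) p x := by
  refine ⟨11 + |S 1|, by linarith [abs_nonneg (S 1)], fun n p hp x hx => ?_⟩
  have h := prod_le_condVar hG hS hp.injective hp.abs_le hx
  set m : ℝ := (n : ℝ) + 2 with hm
  have hm0 : 0 ≤ (n : ℝ) := Nat.cast_nonneg n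
  have e1 : 4 * (((n + 1 : ℕ) : ℝ) + 1) = 4 * m := by rw [hm]; push_cast; ring
  rw [e1] at h
  have h1 : (4 * m) ^ (2 * (n + 1) + 1) ≤ Real.exp (8 * m ^ 2) := by
    have h2 : 4 * m ≤ Real.exp (4 * m) := by linarith [Real.add_one_le_exp (4 * m)]
    refine (pow_le_pow_left₀ (by positivity) h2 _).trans ?_
    rw [← Real.exp_nat_mul]
    refine Real.exp_le_exp.2 ?_
    push_cast
    nlinarith
  have h4 : (4 : ℝ) ^ n ≤ Real.exp (3 * m ^ 2) := by
    have h2 : (4 : ℝ) ≤ Real.exp 3 := by linarith [Real.add_one_le_exp (3 : ℝ)]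
    refine (pow_le_pow_left₀ (by positivity) h2 _).trans ?_
    rw [← Real.exp_nat_mul]
    refine Real.exp_le_exp.2 ?_
    nlinarith
  set W := ∏ k, (x - p k) ^ 2 with hW
  have hW0 : 0 ≤ W := Finset.prod_nonneg fun k _ => by positivity
  set v := condVar (fun a b => G (a - b)) p x with hv
  have hv0 : 0 ≤ v := by
    by_contra hneg
    have h5 : 0 ≤ Real.exp (-S 1) * W := by positivity
    have h6 : (4 * m) ^ (2 * (n + 1) + 1) * v < 0 :=
      mul_neg_of_pos_of_neg (by positivity) (not_le.1 hneg)
    linarith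
  have h7 : Real.exp (-S 1) * W ≤ Real.exp (8 * m ^ 2) * v :=
    h.trans (mul_le_mul_of_nonneg_right h1 hv0)
  have h8 : S 1 ≤ |S 1| * m ^ 2 :=
    (le_abs_self _).trans (le_mul_of_one_le_right (abs_nonneg _) (by nlinarith))
  calc Real.exp (-(11 + |S 1|) * m ^ 2) ^ 2 * 4 ^ n * W
      ≤ Real.exp (-(11 + |S 1|) * m ^ 2) ^ 2 * Real.exp (3 * m ^ 2) * W := by gcongr
    _ = Real.exp (-19 * m ^ 2 - 2 * (|S 1| * m ^ 2)) * W := by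
        rw [← Real.exp_nat_mul, ← Real.exp_add]; congr 2; push_cast; ring
    _ ≤ Real.exp (-8 * m ^ 2 + -S 1) * W := by
        refine mul_le_mul_of_nonneg_right (Real.exp_le_exp.2 ?_) hW0
        nlinarith [abs_nonneg (S 1), sq_nonneg m]
    _ = Real.exp (-8 * m ^ 2) * (Real.exp (-S 1) * W) := by rw [Real.exp_add]; ring
    _ ≤ Real.exp (-8 * m ^ 2) * (Real.exp (8 * m ^ 2) * v) := by gcongr
    _ = v := by rw [← mul_assoc, ← Real.exp_add]; simp

/-- A point so close to the origin that the gap `G(0) - G(y)` is below the conditional standard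
deviation has a large expected improvement. -/
theorem exists_exp_mul_prod_sq_le_expectedImprovement (hG : HasSpectralDensity G Ghat)
    (hS : IsRapidlyDecaying Ghat S) : ∃ B : ℝ, 0 ≤ B ∧ ∀ (n : ℕ) (p : Fin (n + 1) → ℝ),
      IsAdmissible p → ∃ y ∈ Icc (-1 : ℝ) 1,
        Real.exp (-B * (n + 2) ^ 2) * (∏ k : Fin n, |p k.succ|) ^ 2 ≤
          expectedImprovement (fun a b => G (a - b)) p (fun k => -G (p k)) y := by
  obtain ⟨B, hB, hvar⟩ := exists_exp_mul_prod_le_condVar hG hS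
  obtain ⟨C, hC, hgap⟩ := exists_gap_le_sq hG hS
  have hC0 : 0 < C := one_pos.trans_le hC
  refine ⟨2 * B + |Real.log (normalTail / C)|, by positivity, fun n p hp => ?_⟩
  set m : ℝ := (n : ℝ) + 2 with hm
  have hm2 : 2 ≤ m := by rw [hm]; linarith [Nat.cast_nonneg (α := ℝ) n]
  set P := ∏ k : Fin n, |p k.succ| with hP
  set D := Real.exp (-B * m ^ 2) with hD
  have hne : ∀ k : Fin n, 0 < |p k.succ| := fun k => abs_pos.2 fun h0 =>
    Fin.succ_ne_zero k (hp.injective (h0.trans hp.zero.symm))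
  have hP0 : 0 < P := Finset.prod_pos fun k _ => hne k
  have hPle : ∀ k : Fin n, P ≤ |p k.succ| := fun k => by
    rw [hP, ← Finset.mul_prod_erase _ _ (Finset.mem_univ k)]
    exact mul_le_of_le_one_right (abs_nonneg _)
      (Finset.prod_le_one (fun i _ => abs_nonneg _) fun i _ => hp.abs_le _)
  have hP1 : P ≤ 1 := Finset.prod_le_one (fun i _ => abs_nonneg _) fun i _ => hp.abs_le _
  have hD0 : 0 < D := Real.exp_pos _
  have hDhalf : D ≤ 1 / 2 := by
    have h1 : 2 ≤ Real.exp (B * m ^ 2) := by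
      nlinarith [Real.add_one_le_exp (B * m ^ 2)]
    rw [hD, neg_mul, Real.exp_neg, ← one_div]
    exact one_div_le_one_div_of_le two_pos h1
  -- the largest order of `y` for which the gap, at most `C y²`, is below `D P y`, a lower bound for
  -- the conditional standard deviation
  set y := P * D / C with hy
  have hy0 : 0 < y := by positivity
  have hyP : y ≤ P / 2 := by
    rw [hy, div_le_iff₀ hC0]
    nlinarith
  have hy1 : |y| ≤ 1 := by rw [abs_of_pos hy0]; linarith
  refine ⟨y, abs_le.1 hy1, ?_⟩
  have hprod : (y * P) ^ 2 ≤ 4 ^ n * ∏ k, (y - p k) ^ 2 := by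
    rw [Fin.prod_univ_succ, hp.zero, sub_zero, mul_pow, mul_left_comm]
    refine mul_le_mul_of_nonneg_left ?_ (sq_nonneg y)
    have h4 : (4 : ℝ) ^ n = ∏ _k : Fin n, (4 : ℝ) := by simp
    rw [h4, ← Finset.prod_mul_distrib, hP, ← Finset.prod_pow]
    refine Finset.prod_le_prod (fun k _ => by positivity) fun k _ => ?_
    have h5 : |p k.succ| ≤ 2 * |y - p k.succ| := by
      have h6 := abs_sub_abs_le_abs_sub (p k.succ) y
      rw [abs_sub_comm, abs_of_pos hy0] at h6
      linarith [hPle k]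
    calc |p k.succ| ^ 2 ≤ (2 * |y - p k.succ|) ^ 2 := by gcongr
      _ = 4 * (y - p k.succ) ^ 2 := by rw [mul_pow, sq_abs]; norm_num
  have hs : (D * (y * P)) ^ 2 ≤ condVar (fun a b => G (a - b)) p y := by
    refine le_trans ?_ (hvar n p hp y hy1)
    rw [mul_pow, mul_assoc]
    exact mul_le_mul_of_nonneg_left hprod (by positivity)
  have hgap' : G 0 - G y ≤ D * (y * P) := by
    refine (hgap y).trans_eq ?_
    rw [hy]; field_simp
  refine le_trans ?_ (le_expectedImprovement_neg hG hS hp.injective hp.abs_le hp.zero hs hgap')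
  have hc := exp_neg_abs_log_mul_sq_le (div_pos normalTail_pos hC0) (m := m) (by linarith)
  calc Real.exp (-(2 * B + |Real.log (normalTail / C)|) * m ^ 2) * P ^ 2
      = D ^ 2 * Real.exp (-|Real.log (normalTail / C)| * m ^ 2) * P ^ 2 := by
        rw [hD, ← Real.exp_nat_mul, ← Real.exp_add]; congr 2; push_cast; ring
    _ ≤ D ^ 2 * (normalTail / C) * P ^ 2 := by gcongr
    _ = _ := by rw [hy]; ring

theorem IsRapidlyDecaying.exists_rate_add_le (hS : IsRapidlyDecaying Ghat S) :
    ∃ V, ∀ K : ℕ, rate S K + 8 * K ≤ V := by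
  have h : IsBoundedUnder (· ≤ ·) atTop fun K : ℕ => rate S K + 8 * K :=
    ⟨0, eventually_map.2 ((hS.eventually_rate_le 8).mono fun K hK => by linarith)⟩
  obtain ⟨V, hV⟩ := h.bddAbove_range
  exact ⟨V, fun K => hV (mem_range_self K)⟩

theorem exists_expectedImprovement_le_mul_prod (hG : HasSpectralDensity G Ghat)
    (hS : IsRapidlyDecaying Ghat S) : ∃ V : ℝ, 0 < V ∧ ∀ (n : ℕ) (p : Fin (n + 1) → ℝ),
      IsAdmissible p → ∀ y, |y| ≤ 1 → (∀ k, y ≠ p k) →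
        expectedImprovement (fun a b => G (a - b)) p (fun k => -G (p k)) y ≤
          V * ∏ k, |y - p k| := by
  obtain ⟨V, hV⟩ := hS.exists_rate_add_le
  refine ⟨3 * Real.exp (V / 2), by positivity, fun n p hp y hy hne => ?_⟩
  set s := Real.exp (V / 2) * ∏ k, |y - p k| with hs
  have hs0 : 0 < s := mul_pos (Real.exp_pos _)
    (Finset.prod_pos fun k _ => abs_pos.2 (sub_ne_zero.2 (hne k)))
  have hvar : condVar (fun a b => G (a - b)) p y ≤ s ^ 2 := by
    refine (condVar_le_exp_rate hG hS n.succ_pos hp.injective hp.abs_le y).trans ?_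
    rw [hs, mul_pow, ← Finset.prod_pow, ← Real.exp_nat_mul]
    simp only [sq_abs]
    refine mul_le_mul_of_nonneg_right (Real.exp_le_exp.2 ?_)
      (Finset.prod_nonneg fun k _ => by positivity)
    refine (hV (n + 1)).trans_eq ?_
    push_cast; ring
  refine (expectedImprovement_neg_le hG hS hp.injective hp.abs_le hp.zero (one_div_pos.2 hs0)
    (sq_nonneg s) hvar).trans ?_
  have hgap : 0 ≤ G 0 - G y := le_trans (by positivity) (sq_le_gap hG hS hy)
  have h1 : Real.exp (-(1 / s) * (G 0 - G y) + s ^ 2 * (1 / s) ^ 2 / 2) ≤ 3 := by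
    refine le_trans (Real.exp_le_exp.2 ?_) Real.exp_one_lt_three.le
    have h2 : s ^ 2 * (1 / s) ^ 2 = 1 := by field_simp
    have h3 : 0 ≤ 1 / s * (G 0 - G y) := by positivity
    rw [h2]; linarith
  rw [div_div_eq_mul_div, div_one, mul_assoc, ← hs]
  gcongr

/-- The expected improvement vanishes at the observed points and is positive elsewhere near the
origin, so that a new point is chosen at each step. -/
theorem ne_of_isMaxOn_expectedImprovement (hG : HasSpectralDensity G Ghat)
    (hS : IsRapidlyDecaying Ghat S) {n : ℕ} {p : Fin (n + 1) → ℝ} (hp : IsAdmissible p) {y : ℝ}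
    (hmax : IsMaxOn (expectedImprovement (fun a b => G (a - b)) p (fun k => -G (p k)))
      (Icc (-1) 1) y) (k : Fin (n + 1)) : y ≠ p k := by
  rintro rfl
  obtain ⟨B, -, hB⟩ := exists_exp_mul_prod_sq_le_expectedImprovement hG hS
  obtain ⟨z, hz, hle⟩ := hB n p hp
  have h1 := hle.trans ((hmax hz).trans
    (expectedImprovement_neg_apply_le hG hS hp.injective hp.abs_le hp.zero k))
  have h2 : (0 : ℝ) < ∏ k : Fin n, |p k.succ| := Finset.prod_pos fun k _ => abs_pos.2 fun h0 =>
    Fin.succ_ne_zero k (hp.injective (h0.trans hp.zero.symm))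
  exact h1.not_gt (by positivity)

theorem exists_exp_mul_prod_le_abs_of_isMaxOn (hG : HasSpectralDensity G Ghat)
    (hS : IsRapidlyDecaying Ghat S) : ∃ B : ℝ, 0 ≤ B ∧ ∀ (n : ℕ) (p : Fin (n + 1) → ℝ),
      IsAdmissible p → ∀ y ∈ Icc (-1 : ℝ) 1,
        IsMaxOn (expectedImprovement (fun a b => G (a - b)) p (fun k => -G (p k)))
          (Icc (-1) 1) y →
        Real.exp (-B * (n + 2) ^ 2) * ∏ k : Fin n, |p k.succ| ≤ |y| := by
  obtain ⟨B, hB0, hB⟩ := exists_exp_mul_prod_sq_le_expectedImprovement hG hS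
  obtain ⟨V, hV0, hV⟩ := exists_expectedImprovement_le_mul_prod hG hS
  refine ⟨B + 1 + |Real.log (1 / V)|, by positivity, fun n p hp y hy hmax => ?_⟩
  have hne := ne_of_isMaxOn_expectedImprovement hG hS hp hmax
  obtain ⟨z, hz, hle⟩ := hB n p hp
  have hyabs : |y| ≤ 1 := abs_le.2 hy
  have h1 := hle.trans ((hmax hz).trans (hV n p hp y hyabs hne))
  set P := ∏ k : Fin n, |p k.succ| with hP
  have hpos : ∀ k : Fin n, 0 < |p k.succ| := fun k => abs_pos.2 fun h0 =>
    Fin.succ_ne_zero k (hp.injective (h0.trans hp.zero.symm))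
  have hP0 : 0 < P := Finset.prod_pos fun k _ => hpos k
  set m : ℝ := (n : ℝ) + 2 with hm
  have hm2 : 2 ≤ m := by rw [hm]; linarith [Nat.cast_nonneg (α := ℝ) n]
  -- unless `|y|` exceeds some `|p_k| ≥ P`, all the factors `|y - p_k|` are at most `2 |p_k|`
  by_cases hbig : ∃ k : Fin n, |p k.succ| < |y|
  · obtain ⟨k, hk⟩ := hbig
    have h2 : P ≤ |p k.succ| := by
      rw [hP, ← Finset.mul_prod_erase _ _ (Finset.mem_univ k)]
      exact mul_le_of_le_one_right (abs_nonneg _)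
        (Finset.prod_le_one (fun i _ => abs_nonneg _) fun i _ => hp.abs_le _)
    refine le_trans (mul_le_of_le_one_left hP0.le (Real.exp_le_one_iff.2 ?_)) (h2.trans hk.le)
    have : 0 ≤ (B + 1 + |Real.log (1 / V)|) * m ^ 2 := by positivity
    linarith
  · push Not at hbig
    have h2 : ∏ k, |y - p k| ≤ |y| * (2 ^ n * P) := by
      rw [Fin.prod_univ_succ, hp.zero, sub_zero]
      refine mul_le_mul_of_nonneg_left ?_ (abs_nonneg y)
      have h4 : (2 : ℝ) ^ n = ∏ _k : Fin n, (2 : ℝ) := by simp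
      rw [h4, hP, ← Finset.prod_mul_distrib]
      refine Finset.prod_le_prod (fun k _ => abs_nonneg _) fun k _ => ?_
      exact (abs_sub _ _).trans (by linarith [hbig k])
    have h3 : Real.exp (-B * m ^ 2) * P ≤ V * 2 ^ n * |y| := by
      have h5 := h1.trans (mul_le_mul_of_nonneg_left h2 hV0.le)
      refine le_of_mul_le_mul_right ?_ hP0
      calc Real.exp (-B * m ^ 2) * P * P = Real.exp (-B * m ^ 2) * P ^ 2 := by ring
        _ ≤ _ := h5
        _ = _ := by ring
    have h6 := exp_neg_abs_log_mul_sq_le (one_div_pos.2 hV0) (m := m) (by linarith)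
    have h7 : Real.exp (-m ^ 2) * 2 ^ n ≤ 1 := by
      have h8 : (2 : ℝ) ≤ Real.exp 1 := by linarith [Real.add_one_le_exp (1 : ℝ)]
      have h9 : (2 : ℝ) ^ n ≤ Real.exp (m ^ 2) := by
        refine (pow_le_pow_left₀ zero_le_two h8 n).trans ?_
        rw [← Real.exp_nat_mul]
        exact Real.exp_le_exp.2 (by nlinarith)
      rw [Real.exp_neg, inv_mul_le_iff₀ (Real.exp_pos _), mul_one]
      exact h9
    calc Real.exp (-(B + 1 + |Real.log (1 / V)|) * m ^ 2) * P
        = Real.exp (-|Real.log (1 / V)| * m ^ 2) * Real.exp (-m ^ 2) *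
          (Real.exp (-B * m ^ 2) * P) := by
          rw [← mul_assoc, ← Real.exp_add, ← Real.exp_add]; congr 2; ring
      _ ≤ (1 / V) * Real.exp (-m ^ 2) * (V * 2 ^ n * |y|) := by gcongr
      _ = (Real.exp (-m ^ 2) * 2 ^ n) * |y| := by field_simp
      _ ≤ |y| := mul_le_of_le_one_left (abs_nonneg y) h7

end

/-! ### Trajectories -/

section

variable {G Ghat S : ℝ → ℝ} {x : ℕ → ℝ}

theorem IsTrajectory.isAdmissible (hG : HasSpectralDensity G Ghat) (hS : IsRapidlyDecaying Ghat S)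
    (hx : IsTrajectory (fun a b => G (a - b)) (Icc (-1 : ℝ) 1) (fun a => -G a) x) (hx1 : x 1 = 0)
    (n : ℕ) : IsAdmissible fun k : Fin (n + 1) => x (k + 1) := by
  have habs : ∀ k : ℕ, |x (k + 1)| ≤ 1 := fun k => by
    rcases Nat.eq_zero_or_pos k with rfl | hk
    · exact abs_le.2 hx.1
    · exact abs_le.2 (hx.2 k hk).1
  induction n with
  | zero => exact ⟨fun i j _ => Subsingleton.elim (α := Fin 1) i j, fun k => habs k, by simpa using hx1⟩
  | succ n ih =>
    refine ⟨Function.Injective.of_lt_imp_ne fun i j hij => ?_, fun k => habs k, by simpa using hx1⟩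
    have hi : (i : ℕ) < n + 1 := by have := j.2; have : (i : ℕ) < j := hij; omega
    rcases Nat.lt_or_ge j (n + 1) with hj | hj
    · intro h
      have := ih.injective (a₁ := ⟨i, hi⟩) (a₂ := ⟨j, hj⟩) h
      rw [Fin.mk.injEq] at this
      exact hij.ne (Fin.ext this)
    · have hj' : (j : ℕ) = n + 1 := by have := j.2; omega
      have := ne_of_isMaxOn_expectedImprovement hG hS ih (hx.2 (n + 1) n.succ_pos).2 ⟨i, hi⟩
      simp only [hj']
      exact this.symm

/-- The recursion `P_{n+1} ≥ e^{-O(n²)} P_n²` for the products `P_n = ∏ |x_k|`, `2 ≤ k ≤ n + 1`. -/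
theorem IsTrajectory.exists_exp_le_prod (hG : HasSpectralDensity G Ghat)
    (hS : IsRapidlyDecaying Ghat S)
    (hx : IsTrajectory (fun a b => G (a - b)) (Icc (-1 : ℝ) 1) (fun a => -G a) x) (hx1 : x 1 = 0) :
    ∃ A : ℝ, 0 ≤ A ∧ ∀ n : ℕ, Real.exp (-A * 2 ^ n) ≤ ∏ k : Fin n, |x (k + 2)| := by
  obtain ⟨B, hB0, hB⟩ := exists_exp_mul_prod_le_abs_of_isMaxOn hG hS
  refine ⟨11 * B, by positivity, fun n => ?_⟩
  have hstep : ∀ n : ℕ, Real.exp (-B * (n + 2) ^ 2) * ∏ k : Fin n, |x (k + 2)| ≤ |x (n + 2)| :=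
    fun n => hB n _ (hx.isAdmissible hG hS hx1 n) _ (hx.2 (n + 1) n.succ_pos).1
      (hx.2 (n + 1) n.succ_pos).2
  -- the quadratic correction turns the recursion `a_{n+1} ≤ 2 a_n + B (n + 2)²` into a doubling
  have hmain : ∀ n : ℕ, Real.exp (B * ((n + 2) ^ 2 + 2 * (n + 2) + 3) - 11 * B * 2 ^ n) ≤
      ∏ k : Fin n, |x (k + 2)| := fun n => by
    induction n with
    | zero => simp; ring_nf; exact le_rfl
    | succ n ih =>
      rw [Fin.prod_univ_castSucc]
      simp only [Fin.val_castSucc, Fin.val_last]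
      set P := ∏ k : Fin n, |x (k + 2)| with hP
      have hP0 : 0 ≤ P := (Real.exp_nonneg _).trans ih
      calc _ = Real.exp (B * ((n + 2) ^ 2 + 2 * (n + 2) + 3) - 11 * B * 2 ^ n) *
            (Real.exp (-B * (n + 2) ^ 2) *
              Real.exp (B * ((n + 2) ^ 2 + 2 * (n + 2) + 3) - 11 * B * 2 ^ n)) := by
            rw [← Real.exp_add, ← Real.exp_add]; congr 1; push_cast; ring
        _ ≤ P * (Real.exp (-B * (n + 2) ^ 2) * P) := by gcongr
        _ ≤ P * |x (n + 2)| := mul_le_mul_of_nonneg_left (hstep n) hP0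
  refine le_trans (Real.exp_le_exp.2 ?_) (hmain n)
  have : 0 ≤ B * (((n : ℝ) + 2) ^ 2 + 2 * (n + 2) + 3) := by positivity
  linarith

theorem IsTrajectory.eventually_exp_rate_le_abs (hG : HasSpectralDensity G Ghat)
    (hS : IsRapidlyDecaying Ghat S)
    (hx : IsTrajectory (fun a b => G (a - b)) (Icc (-1 : ℝ) 1) (fun a => -G a) x) (hx1 : x 1 = 0) :
    ∀ᶠ K : ℕ in atTop, Real.exp (2 ^ K * rate S K) ≤ |x (K + 1)| := by
  obtain ⟨A, hA0, hA⟩ := hx.exists_exp_le_prod hG hS hx1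
  filter_upwards [hS.eventually_rate_le A, eventually_ge_atTop 1] with K hK hK1
  obtain ⟨n, rfl⟩ : ∃ n, K = n + 1 := ⟨K - 1, by omega⟩
  have h1 := hA (n + 1)
  rw [Fin.prod_univ_castSucc] at h1
  simp only [Fin.val_castSucc, Fin.val_last] at h1
  have h2 : ∏ k : Fin n, |x (k + 2)| ≤ 1 := Finset.prod_le_one (fun _ _ => abs_nonneg _)
    fun k _ => (hx.isAdmissible hG hS hx1 (n + 1)).abs_le k.succ.castSucc
  refine le_trans (Real.exp_le_exp.2 ?_) (h1.trans (mul_le_of_le_one_left (abs_nonneg _) h2))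
  have h3 : (1 : ℝ) ≤ ((n + 1 : ℕ) : ℝ) := by exact_mod_cast hK1
  have h4 : rate S (n + 1) ≤ -A := hK.trans (by nlinarith)
  have h5 : (0 : ℝ) < 2 ^ (n + 1) := by positivity
  nlinarith

/-- At a point with `|y| > e^{F(K)/3}` the gap `G(0) - G(y)` is so many conditional standard
deviations that the expected improvement is doubly exponentially small in `|F(K)|`, which is less
than its maximum. -/
theorem IsTrajectory.eventually_abs_le_exp_rate (hG : HasSpectralDensity G Ghat)
    (hS : IsRapidlyDecaying Ghat S)
    (hx : IsTrajectory (fun a b => G (a - b)) (Icc (-1 : ℝ) 1) (fun a => -G a) x) (hx1 : x 1 = 0) :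
    ∀ᶠ K : ℕ in atTop, |x (K + 1)| ≤ Real.exp (rate S K / 3) := by
  obtain ⟨A, hA0, hA⟩ := hx.exists_exp_le_prod hG hS hx1
  obtain ⟨B, hB0, hB⟩ := exists_exp_mul_prod_sq_le_expectedImprovement hG hS
  set c := Real.exp (-S 1) / 24 with hc
  have hc0 : 0 < c := by positivity
  have hlim : Tendsto (fun K : ℕ => (4 : ℝ) ^ K) atTop atTop :=
    tendsto_pow_atTop_atTop_of_one_lt (by norm_num)
  filter_upwards [hS.eventually_rate_le 42, eventually_ge_atTop 1,
    hlim.eventually_ge_atTop (1 / c),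
    hlim.eventually_gt_atTop ((B + 2 * A) / (c ^ 2 / 2))] with K hrate hK1 hKc hKE
  obtain ⟨n, rfl⟩ : ∃ n, K = n + 1 := ⟨K - 1, by omega⟩
  by_contra! hlt
  set y := x (n + 1 + 1) with hy
  set r := rate S (n + 1) with hr
  set K : ℝ := ((n + 1 : ℕ) : ℝ) with hK
  have hK1' : 1 ≤ K := by rw [hK]; exact_mod_cast hK1
  rw [div_le_iff₀ hc0] at hKc
  rw [div_lt_iff₀ (by positivity)] at hKE
  have hp := hx.isAdmissible hG hS hx1 n
  obtain ⟨hyD, hmax⟩ := hx.2 (n + 1) n.succ_pos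
  have hy1 : |y| ≤ 1 := abs_le.2 hyD
  obtain ⟨z, hz, hle⟩ := hB n _ hp
  have hlow := hle.trans (hmax hz)
  have hvar : condVar (fun a b => G (a - b)) (fun k : Fin (n + 1) => x (k + 1)) y ≤
      Real.exp (r + 10 * K) * y ^ 2 := by
    refine (condVar_le_exp_rate hG hS n.succ_pos hp.injective hp.abs_le y).trans ?_
    rw [Fin.prod_univ_succ]
    simp only [Fin.val_zero, zero_add, hx1, sub_zero, Fin.val_succ]
    have h1 : ∏ k : Fin n, (y - x (k + 1 + 1)) ^ 2 ≤ Real.exp (2 * K) := by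
      have h2 : ∏ k : Fin n, (y - x (k + 1 + 1)) ^ 2 ≤ ∏ _k : Fin n, (4 : ℝ) := by
        refine Finset.prod_le_prod (fun k _ => sq_nonneg _) fun k _ => ?_
        have h3 : |y - x (k + 1 + 1)| ≤ 2 :=
          (abs_sub _ _).trans (by linarith [hp.abs_le k.succ, show |x (k + 1 + 1)| ≤ 1 from
            (hx.isAdmissible hG hS hx1 (n + 1)).abs_le k.succ.castSucc])
        calc (y - x (k + 1 + 1)) ^ 2 = |y - x (k + 1 + 1)| ^ 2 := (sq_abs _).symm
          _ ≤ 2 ^ 2 := by gcongr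
          _ = 4 := by norm_num
      refine h2.trans ?_
      have h4 : (4 : ℝ) ≤ Real.exp 2 := by
        rw [show (2 : ℝ) = 1 + 1 by norm_num, Real.exp_add]
        nlinarith [Real.add_one_le_exp (1 : ℝ)]
      rw [Finset.prod_const, Finset.card_univ, Fintype.card_fin]
      calc (4 : ℝ) ^ n ≤ 4 ^ (n + 1) := pow_le_pow_right₀ (by norm_num) (Nat.le_succ n)
        _ ≤ Real.exp 2 ^ (n + 1) := by gcongr
        _ = Real.exp (2 * K) := by rw [← Real.exp_nat_mul, mul_comm]
    calc _ ≤ Real.exp (r + 8 * K) * (y ^ 2 * Real.exp (2 * K)) := by gcongr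
      _ = _ := by
        rw [mul_left_comm, ← Real.exp_add, mul_comm]; congr 2; ring
  -- this `l` minimizes `exp(-l c y² + l² w / 2)` for the bound `w = e^{r + 10 K} y²` of the variance
  set l := c * Real.exp (-(r + 10 * K)) with hl
  have hE : ∀ u : ℝ, 4 * K ≤ u → (4 : ℝ) ^ (n + 1) * 4 ^ (n + 1) ≤ Real.exp u := fun u hu => by
    have h4 : (16 : ℝ) ≤ Real.exp 4 := by
      have h2 : (2 : ℝ) ≤ Real.exp 1 := by linarith [Real.add_one_le_exp (1 : ℝ)]
      calc (16 : ℝ) = 2 ^ 4 := by norm_num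
        _ ≤ Real.exp 1 ^ 4 := by gcongr
        _ = Real.exp 4 := by rw [← Real.exp_nat_mul]; norm_num
    rw [← mul_pow]
    norm_num only
    refine (pow_le_pow_left₀ (by norm_num) h4 _).trans ?_
    rw [← Real.exp_nat_mul]
    exact Real.exp_le_exp.2 (by linarith)
  have h4one : (1 : ℝ) ≤ 4 ^ (n + 1) := one_le_pow₀ (by norm_num)
  have hl1 : 1 ≤ l := by
    have h5 := hE (-(r + 10 * K)) (by linarith)
    rw [hl]
    nlinarith
  have hl0 : 0 < l := by linarith
  have hup := expectedImprovement_neg_le hG hS hp.injective hp.abs_le (j := 0) hp.zero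
    hl0 (by positivity) hvar
  have hgap := sq_le_gap hG hS hy1
  rw [← hc] at hgap
  have hwl : Real.exp (r + 10 * K) * y ^ 2 * l ^ 2 / 2 = l * (c * y ^ 2) / 2 := by
    have : Real.exp (r + 10 * K) * l = c := by
      rw [hl, mul_left_comm, ← Real.exp_add]; simp
    calc _ = (Real.exp (r + 10 * K) * l) * y ^ 2 * l / 2 := by ring
      _ = _ := by rw [this]; ring
  have hy2 : Real.exp (2 * r / 3) ≤ y ^ 2 := by
    rw [← sq_abs y, show 2 * r / 3 = (2 : ℕ) * (r / 3) by push_cast; ring, Real.exp_nat_mul]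
    gcongr
  have hexp : (B + 2 * A) * 4 ^ (n + 1) < l * (c * y ^ 2) / 2 := by
    have h5 := hE (-(r / 3) - 10 * K) (by linarith)
    have h6 : l * (c * y ^ 2) / 2 ≥ c ^ 2 / 2 * Real.exp (-(r / 3) - 10 * K) := by
      calc l * (c * y ^ 2) / 2 ≥ l * (c * Real.exp (2 * r / 3)) / 2 := by gcongr
        _ = c ^ 2 / 2 * (Real.exp (-(r + 10 * K)) * Real.exp (2 * r / 3)) := by rw [hl]; ring
        _ = _ := by rw [← Real.exp_add]; congr 2; ring
    have h7 : c ^ 2 / 2 * (4 ^ (n + 1) * 4 ^ (n + 1)) ≤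
        c ^ 2 / 2 * Real.exp (-(r / 3) - 10 * K) := by gcongr
    have h8 : (B + 2 * A) * 4 ^ (n + 1) < 4 ^ (n + 1) * (c ^ 2 / 2) * 4 ^ (n + 1) := by gcongr
    linarith
  have hup2 : Real.exp (-l * (G 0 - G y) + Real.exp (r + 10 * K) * y ^ 2 * l ^ 2 / 2) / l <
      Real.exp (-((B + 2 * A) * 4 ^ (n + 1))) := by
    refine (div_le_self (Real.exp_nonneg _) hl1).trans_lt (Real.exp_lt_exp.2 ?_)
    rw [hwl]
    have := mul_le_mul_of_nonneg_left hgap hl0.le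
    linarith
  have hlow2 : Real.exp (-((B + 2 * A) * 4 ^ (n + 1))) ≤
      Real.exp (-B * ((n : ℝ) + 2) ^ 2) * (∏ k : Fin n, |x ((k.succ : Fin (n + 1)) + 1)|) ^ 2 := by
    have h5 : Real.exp (-A * 2 ^ n) ≤ ∏ k : Fin n, |x ((k.succ : Fin (n + 1)) + 1)| := hA n
    have h6 : (2 : ℝ) ^ n ≤ 4 ^ (n + 1) :=
      (pow_le_pow_left₀ zero_le_two (by norm_num) n).trans
        (pow_le_pow_right₀ (by norm_num) (Nat.le_succ n))
    have h7 : ((n : ℝ) + 2) ^ 2 ≤ 4 ^ (n + 1) := by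
      have h8 : n + 2 ≤ 2 ^ (n + 1) := Nat.lt_two_pow_self (n := n + 1)
      have h9 : (n : ℝ) + 2 ≤ 2 ^ (n + 1) := by exact_mod_cast h8
      calc ((n : ℝ) + 2) ^ 2 ≤ (2 ^ (n + 1)) ^ 2 := by gcongr
        _ = 4 ^ (n + 1) := by rw [← pow_mul, mul_comm, pow_mul]; norm_num
    calc _ ≤ Real.exp (-B * ((n : ℝ) + 2) ^ 2 + (2 : ℕ) * (-A * 2 ^ n)) := by
          refine Real.exp_le_exp.2 ?_
          have := mul_le_mul_of_nonneg_left h6 hA0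
          have := mul_le_mul_of_nonneg_left h7 hB0
          push_cast
          linarith
      _ = Real.exp (-B * ((n : ℝ) + 2) ^ 2) * Real.exp (-A * 2 ^ n) ^ 2 := by
          rw [Real.exp_add, Real.exp_nat_mul]
      _ ≤ _ := by gcongr
  exact (hlow2.trans (hlow.trans hup)).not_gt hup2

theorem IsRapidlyDecaying.tendsto_exp_rate (hS : IsRapidlyDecaying Ghat S) :
    Tendsto (fun K : ℕ => Real.exp (rate S K / 3)) atTop (𝓝 0) := by
  refine Real.tendsto_exp_atBot.comp (tendsto_atBot_mono' atTop ?_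
    (tendsto_neg_atTop_atBot.comp tendsto_natCast_atTop_atTop))
  filter_upwards [hS.eventually_rate_le 3] with K hK
  simp only [Function.comp]
  linarith

end

theorem not_Icc_subset_closure_image_of_tendsto {x : ℕ → ℝ} {a : ℝ}
    (hx : Tendsto x atTop (𝓝 a)) (s : Set ℕ) : ¬ Icc (-1 : ℝ) 1 ⊆ closure (x '' s) := by
  intro h
  have hclosed : IsClosed (insert a (range x)) := hx.isCompact_insert_range.isClosed
  have hsub : Icc (-1 : ℝ) 1 ⊆ insert a (range x) :=
    h.trans (closure_minimal ((image_subset_range x s).trans (subset_insert _ _)) hclosed)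
  have hcount : (Icc (-1 : ℝ) 1).Countable := ((countable_range x).insert a).mono hsub
  exact Cardinal.Real.Icc_countable_iff.1 hcount |>.not_gt (by norm_num)

end ExpectedImprovement

theorem theorem3 (G Ghat S : ℝ → ℝ)
    (hG : ExpectedImprovement.HasSpectralDensity G Ghat)
    (hS : ExpectedImprovement.IsRapidlyDecaying Ghat S)
    (x : ℕ → ℝ)
    (hx : ExpectedImprovement.IsTrajectory (fun a b => G (a - b)) (Set.Icc (-1 : ℝ) 1)
      (fun a => -G a) x)
    (hx1 : x 1 = 0) :
    Filter.Tendsto x Filter.atTop (nhds 0) ∧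
    ¬ Set.Icc (-1 : ℝ) 1 ⊆ closure (x '' Set.Ici 1) ∧
    ∀ᶠ K : ℕ in Filter.atTop,
      Real.exp (2 ^ K * ExpectedImprovement.rate S K) ≤ |x (K + 1)| ∧
      |x (K + 1)| ≤ Real.exp (ExpectedImprovement.rate S K / 3) := by
  have hle := hx.eventually_abs_le_exp_rate hG hS hx1
  have hlim : Tendsto x atTop (𝓝 0) := by
    rw [← tendsto_add_atTop_iff_nat 1]
    exact squeeze_zero_norm' hle hS.tendsto_exp_rate
  exact ⟨hlim, ExpectedImprovement.not_Icc_subset_closure_image_of_tendsto hlim _,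
    (hx.eventually_exp_rate_le_abs hG hS hx1).and hle⟩
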